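/- **Language.** Classical first-order logic without identity, with primitive symbols $\neg,\wedge,\vee,\forall,\exists$, denumerably many individual variables and, for each $n\ge 0$, denumerably many $n$-ary predicate variables and $n$-ary functional variables. Terms and formulas are defined as usual. **Data and dual data.** A *datum* $(E\mathbf f)(\mathbf x):\Gamma/\Delta/\dots$ consists of a finite set $\mathbf f$ of functional variables, a finite set $\mathbf x$ of individual variables (together the *prefix*), and a finite set $\{\Gamma,\Delta,\dots\}$ (the *matrix*) of finite sets of formulas (the *components*). A *dual datum* $(\mathbf f)(E\mathbf x):\Gamma;\Delta;\dots$ consists of the same material. Objects that differ only in the names of bound variables (those bound in formulas and those in the prefix) are identified. An interpretation (a nonempty domain with values for all variables) verifies the datum if for some values of $\mathbf f$ and all values of $\mathbf x$ (other variables keeping their values) all formulas of some component are true; it verifies the dual datum if for all values of $\mathbf f$ there are values of $\mathbf x$ such that every component contains a true formula. $\alpha\models\delta$ means that every interpretation verifying $\alpha$ verifies $\delta$. A datum or dual datum is *standard* if (1) all functional variables in the matrix are in the prefix; (2) they are applied in the matrix to individual variables only; (3) for some total ordering of $\mathbf x$, the arguments of every functional term in the matrix are, in order and without repetition, an initial segment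 of the ordering. **Rules of QDC (for data).** $\Gamma,A$ is $\Gamma\cup\{A\}$, $\rho$ is the rest of the matrix, $t$ is any term, and $g\mathbf x$ is $g$ applied to all variables of $\mathbf x$, listed once each in some order. $\updownarrow$ means inference in both directions, and prefixes that do not change are omitted. - $\Gamma,A\wedge B/\rho\updownarrow\Gamma,A,B/\rho$; $\;\Gamma,A\vee B/\rho\updownarrow\Gamma,A/\Gamma,B/\rho$; $\;\Gamma,\neg\neg A/\rho\updownarrow\Gamma,A/\rho$; $\;\Gamma,\neg(A\vee B)/\rho\updownarrow\Gamma,\neg A,\neg B/\rho$; $\;\Gamma,\neg(A\wedge B)/\rho\updownarrow\Gamma,\neg A/\Gamma,\neg B/\rho$. - $(E\mathbf f)(\mathbf x):\forall yA,\Gamma/\rho\updownarrow(E\mathbf f)(\mathbf x,y):A,\Gamma/\rho$ and $(E\mathbf f)(\mathbf x):\neg\exists yA,\Gamma/\rho\updownarrow(E\mathbf f)(\mathbf x,y):\neg A,\Gamma/\rho$, if $y$ is not free in $\Gamma,\rho$. - $(E\mathbf f)(\mathbf x):\exists yA(y),\Gamma/\rho\updownarrow(E\mathbf f,g)(\mathbf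 x):A(g\mathbf x),\Gamma/\rho$ and $(E\mathbf f)(\mathbf x):\neg\forall yA(y),\Gamma/\rho\updownarrow(E\mathbf f,g)(\mathbf x):\neg A(g\mathbf x),\Gamma/\rho$, if $g$ is not in $A(y),\Gamma,\rho$. - NC: from $\Gamma,A,\neg A/\rho$ infer $\rho$. EM: from $\Gamma/\rho$ infer $\Gamma,A/\Gamma,\neg A/\rho$. Del: from $\Gamma\cup\Delta/\rho$ infer $\Gamma/\rho$. Exp: from $\rho$ infer $\Gamma/\rho$. - Inst: from $(E\mathbf f)(\mathbf x,y):\alpha(y)$ infer $(E\mathbf f)(\mathbf x):\alpha(t)$. Gen: from $(E\mathbf f)(\mathbf x):\alpha(t)$ infer $(E\mathbf f,g)(\mathbf x):\alpha(g\mathbf x)$, if $g$ is not in $\alpha(\cdot)$. - EVE: from $(E\mathbf f,g)(\mathbf x):\alpha$ infer $(E\mathbf f)(\mathbf x):\alpha$, if $g$ is not in $\alpha$. IVU: from $(E\mathbf f)(\mathbf x):\alpha$ infer $(E\mathbf f)(\mathbf x,y):\alpha$, if $y$ is not free in $\alpha$. **Rules of QDDC (for dual data).** The duals of these: premiss and conclusion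 are exchanged, $\wedge$ with $\vee$ and $\forall$ with $\exists$ are interchanged, and data are replaced by dual data. **Criss-Crossing.** An *instance* of a datum or dual datum is a matrix obtained by dropping the prefix and uniformly substituting arbitrary terms for the variables of the individual prefix. A component is *pure* if it contains no pair $A,\neg A$. From a datum $(E\mathbf f)(\mathbf x):\alpha$ infer a dual datum $(\mathbf g)(E\mathbf y):\delta$ (bound variables being named so that $\mathbf f$ do not occur in $\delta$ and $\mathbf g$ do not occur in $\alpha$) if there are instances $\alpha_0$ of the first and $\delta_0$ of the second such that every pure component of $\alpha_0$ has a formula in common with every pure component of $\delta_0$. **Deductions in the Quantified Hybrid Calculus QHC.** $\alpha\vdash_{\mathrm{QHC}}\delta$ means that there is a finite sequence $\langle\alpha,\dots,\beta,\varepsilon,\dots,\delta\rangle$ in which $\langle\alpha,\dots,\beta\rangle$ is a sequence of data, each after the first inferred from its predecessor by a rule of QDC; $\varepsilon$ is inferred from $\beta$ by Criss-Crossing; and $\langle\varepsilon,\dots,\delta\rangle$ is a sequence of dual data, each after the first inferred from its predecessor by a rule of QDDC. **Proposition (Deductive completeness of QHC).** For every standard datum $\alpha$ and every standard dual datum $\delta$: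 if $\alpha\models\delta$, then $\alpha\vdash_{\mathrm{QHC}}\delta$. -/

import Mathlib

namespace QHC

/-! ### Terms and formulas

Individual variables are natural numbers. Inside formulas, variables bound by quantifiers are
represented by de Bruijn indices, so that formulas differing only in the names of bound variables
are literally identical; free individual variables (and the variables of the prefix of a datum)
are named. -/

/-- Functional variables: denumerably many of each arity `n ≥ 0`. -/
structure FVar where
  arity : ℕ
  idx : ℕ
deriving DecidableEq

/-- Predicate variables: denumerably many of each arity `n ≥ 0`. -/
structure PVar where
  arity : ℕ
  idx : ℕ

/-- Terms in the scope of `k` quantifiers. -/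
inductive Term (k : ℕ) : Type
  | var (x : ℕ) : Term k
  | bvar (i : Fin k) : Term k
  | app (f : FVar) (args : Fin f.arity → Term k) : Term k

/-- Formulas in the scope of `k` further quantifiers; in `all A` and `ex A` the index `0` of `A`
is the bound one. Ordinary formulas are the elements of `Formula 0`. -/
inductive Formula : ℕ → Type
  | atom {k : ℕ} (P : PVar) (args : Fin P.arity → Term k) : Formula k
  | neg {k : ℕ} (A : Formula k) : Formula k
  | and {k : ℕ} (A B : Formula k) : Formula k
  | or {k : ℕ} (A B : Formula k) : Formula k
  | all {k : ℕ} (A : Formula (k + 1)) : Formula k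
  | ex {k : ℕ} (A : Formula (k + 1)) : Formula k

noncomputable instance {k : ℕ} : DecidableEq (Formula k) := Classical.decEq _

/-! ### Substitution -/

/-- Simultaneous substitution of terms for the free variables and for the indices. -/
def Term.bind {m n : ℕ} (s : ℕ → Term n) (b : Fin m → Term n) : Term m → Term n
  | .var x => s x
  | .bvar i => b i
  | .app f args => .app f (fun i => (args i).bind s b)

/-- Weakening of a term to the scope of one more quantifier. -/
def Term.lift {k : ℕ} (t : Term k) : Term (k + 1) :=
  t.bind Term.var (fun i => Term.bvar i.succ)

/-- Capture-free simultaneous substitution in formulas. -/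
def Formula.bind : {m : ℕ} → Formula m → {n : ℕ} → (ℕ → Term n) → (Fin m → Term n) → Formula n
  | _, .atom P args, _, s, b => .atom P (fun i => (args i).bind s b)
  | _, .neg A, _, s, b => .neg (A.bind s b)
  | _, .and A B, _, s, b => .and (A.bind s b) (B.bind s b)
  | _, .or A B, _, s, b => .or (A.bind s b) (B.bind s b)
  | _, .all A, n, s, b =>
      .all (A.bind (fun x => (s x).lift)
        (Fin.cases (motive := fun _ => Term (n + 1)) (.bvar 0) (fun i => (b i).lift)))
  | _, .ex A, n, s, b =>
      .ex (A.bind (fun x => (s x).lift)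
        (Fin.cases (motive := fun _ => Term (n + 1)) (.bvar 0) (fun i => (b i).lift)))

/-- `A(t)`, where `A = A(y)` is the body of a quantified formula `∀ y A(y)` or `∃ y A(y)`. -/
def Formula.inst (A : Formula 1) (t : Term 0) : Formula 0 :=
  A.bind Term.var (fun _ => t)

/-- Uniform substitution of terms for the free individual variables of a formula. -/
def Formula.subst (s : ℕ → Term 0) (A : Formula 0) : Formula 0 :=
  A.bind s Fin.elim0

/-! ### Occurrences of variables -/

/-- The individual variable `x` occurs in the term. -/
def Term.HasVar {k : ℕ} (x : ℕ) : Term k → Prop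
  | .var y => y = x
  | .bvar _ => False
  | .app _ args => ∃ i, (args i).HasVar x

/-- The functional variable `g` occurs in the term. -/
def Term.HasFunc {k : ℕ} (g : FVar) : Term k → Prop
  | .var _ => False
  | .bvar _ => False
  | .app f args => f = g ∨ ∃ i, (args i).HasFunc g

/-- The individual variable `x` occurs free in the formula. -/
def Formula.HasVar (x : ℕ) : {k : ℕ} → Formula k → Prop
  | _, .atom _ args => ∃ i, (args i).HasVar x
  | _, .neg A => A.HasVar x
  | _, .and A B => A.HasVar x ∨ B.HasVar x
  | _, .or A B => A.HasVar x ∨ B.HasVar x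
  | _, .all A => A.HasVar x
  | _, .ex A => A.HasVar x

/-- The functional variable `g` occurs in the formula. -/
def Formula.HasFunc (g : FVar) : {k : ℕ} → Formula k → Prop
  | _, .atom _ args => ∃ i, (args i).HasFunc g
  | _, .neg A => A.HasFunc g
  | _, .and A B => A.HasFunc g ∨ B.HasFunc g
  | _, .or A B => A.HasFunc g ∨ B.HasFunc g
  | _, .all A => A.HasFunc g
  | _, .ex A => A.HasFunc g

/-! ### Renaming of individual and functional variables -/

/-- Arity-preserving renaming of functional variables. -/
def FVar.rename (τ : ℕ → Equiv.Perm ℕ) (f : FVar) : FVar := ⟨f.arity, τ f.arity f.idx⟩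

def Term.rename (σ : Equiv.Perm ℕ) (τ : ℕ → Equiv.Perm ℕ) {k : ℕ} : Term k → Term k
  | .var x => .var (σ x)
  | .bvar i => .bvar i
  | .app f args => .app (f.rename τ) (fun i : Fin f.arity => (args i).rename σ τ)

def Formula.rename (σ : Equiv.Perm ℕ) (τ : ℕ → Equiv.Perm ℕ) : {k : ℕ} → Formula k → Formula k
  | _, .atom P args => .atom P (fun i => (args i).rename σ τ)
  | _, .neg A => .neg (A.rename σ τ)
  | _, .and A B => .and (A.rename σ τ) (B.rename σ τ)
  | _, .or A B => .or (A.rename σ τ) (B.rename σ τ)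
  | _, .all A => .all (A.rename σ τ)
  | _, .ex A => .ex (A.rename σ τ)

/-! ### Interpretations -/

/-- Interpretations with domain `D` (nonempty, because the individual variables have values). -/
structure Interp (D : Type) where
  ind : ℕ → D
  func : (f : FVar) → (Fin f.arity → D) → D
  pred : (P : PVar) → (Fin P.arity → D) → Prop

/-- The value of a term; `e` gives the values of the bound variables in whose scope it stands. -/
def Term.eval {D : Type} (I : Interp D) {k : ℕ} (e : Fin k → D) : Term k → D
  | .var x => I.ind x
  | .bvar i => e i
  | .app f args => I.func f (fun i => (args i).eval I e)

/-- Truth of a formula. -/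
def Formula.Holds {D : Type} (I : Interp D) : {k : ℕ} → (Fin k → D) → Formula k → Prop
  | _, e, .atom P args => I.pred P (fun i => (args i).eval I e)
  | _, e, .neg A => ¬ A.Holds I e
  | _, e, .and A B => A.Holds I e ∧ B.Holds I e
  | _, e, .or A B => A.Holds I e ∨ B.Holds I e
  | _, e, .all A => ∀ d : D, A.Holds I (Fin.cons d e)
  | _, e, .ex A => ∃ d : D, A.Holds I (Fin.cons d e)

/-- Truth of an ordinary formula. -/
def Formula.IsTrue {D : Type} (I : Interp D) (A : Formula 0) : Prop := A.Holds I Fin.elim0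

/-! ### Proto-data -/

/-- A component: a finite set of formulas. -/
abbrev Comp := Finset (Formula 0)

/-- A matrix: a finite set of components. -/
abbrev Mat := Finset Comp

noncomputable def Mat.rename (σ : Equiv.Perm ℕ) (τ : ℕ → Equiv.Perm ℕ) (M : Mat) : Mat :=
  M.image (fun Γ => Γ.image (Formula.rename σ τ))

noncomputable def Mat.subst (s : ℕ → Term 0) (M : Mat) : Mat :=
  M.image (fun Γ => Γ.image (Formula.subst s))

def Mat.HasVar (x : ℕ) (M : Mat) : Prop := ∃ Γ ∈ M, ∃ A ∈ Γ, A.HasVar x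

def Mat.HasFunc (g : FVar) (M : Mat) : Prop := ∃ Γ ∈ M, ∃ A ∈ Γ, A.HasFunc g

/-- Data and dual data before the identification of objects that differ only in the names of bound
variables: a finite set of functional variables, a finite set of individual variables and a matrix.
Qua datum this is `(E funcs)(inds): matrix`, with the matrix a disjunction of conjunctions; qua
dual datum it is `(funcs)(E inds): matrix`, with the matrix a conjunction of disjunctions. -/
structure Proto where
  funcs : Finset FVar
  inds : Finset ℕ
  mat : Mat

noncomputable def Proto.rename (σ : Equiv.Perm ℕ) (τ : ℕ → Equiv.Perm ℕ) (X : Proto) : Proto :=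
  ⟨X.funcs.image (FVar.rename τ), X.inds.image σ, X.mat.rename σ τ⟩

/-- `Y` results from `X` by an (injective, arity-preserving) renaming of the variables of the
prefix that leaves all free variables as they are. (A renaming of finitely many variables
is extended here to a permutation of all variables.) -/
def Proto.Similar (X Y : Proto) : Prop :=
  ∃ (σ : Equiv.Perm ℕ) (τ : ℕ → Equiv.Perm ℕ),
    (∀ x, X.mat.HasVar x → x ∉ X.inds → σ x = x) ∧
    (∀ f, X.mat.HasFunc f → f ∉ X.funcs → f.rename τ = f) ∧
    Y = X.rename σ τ

/-- Verification of `(E funcs)(inds): matrix` by an interpretation. -/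
def Proto.VerifiedAsDatum {D : Type} (I : Interp D) (X : Proto) : Prop :=
  ∃ F : (f : FVar) → (Fin f.arity → D) → D, (∀ f, f ∉ X.funcs → F f = I.func f) ∧
    ∀ a : ℕ → D, (∀ x, x ∉ X.inds → a x = I.ind x) →
      ∃ Γ ∈ X.mat, ∀ A ∈ Γ, Formula.IsTrue ⟨a, F, I.pred⟩ A

/-- Verification of `(funcs)(E inds): matrix` by an interpretation. -/
def Proto.VerifiedAsDual {D : Type} (I : Interp D) (X : Proto) : Prop :=
  ∀ F : (f : FVar) → (Fin f.arity → D) → D, (∀ f, f ∉ X.funcs → F f = I.func f) →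
    ∃ a : ℕ → D, (∀ x, x ∉ X.inds → a x = I.ind x) ∧
      ∀ Γ ∈ X.mat, ∃ A ∈ Γ, Formula.IsTrue ⟨a, F, I.pred⟩ A

/-! ### Helper facts: renaming generates an equivalence relation and preserves verification -/

theorem FVar.rename_inj {τ : ℕ → Equiv.Perm ℕ} {f g : FVar} (h : f.rename τ = g.rename τ) :
    f = g := by
  obtain ⟨n, i⟩ := f
  obtain ⟨m, j⟩ := g
  simp only [FVar.rename, FVar.mk.injEq] at h
  obtain ⟨rfl, h⟩ := h
  simpa using h

theorem Term.rename_one {k : ℕ} (t : Term k) : t.rename 1 (fun _ => 1) = t := by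
  induction t with
  | var x => rfl
  | bvar i => rfl
  | app f args ih => simp only [Term.rename, ih]; rfl

theorem Term.rename_rename (σ σ' : Equiv.Perm ℕ) (τ τ' : ℕ → Equiv.Perm ℕ) {k : ℕ} (t : Term k) :
    (t.rename σ τ).rename σ' τ' = t.rename (σ' * σ) (fun n => τ' n * τ n) := by
  induction t with
  | var x => rfl
  | bvar i => rfl
  | app f args ih =>
    have h := funext ih
    exact congrArg (Term.app _) h

theorem Formula.rename_one {k : ℕ} (A : Formula k) : A.rename 1 (fun _ => 1) = A := by
  induction A with
  | atom P args => simp only [Formula.rename, Term.rename_one]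
  | neg A ih => simp only [Formula.rename, ih]
  | and A B ihA ihB => simp only [Formula.rename, ihA, ihB]
  | or A B ihA ihB => simp only [Formula.rename, ihA, ihB]
  | all A ih => simp only [Formula.rename, ih]
  | ex A ih => simp only [Formula.rename, ih]

theorem Formula.rename_rename (σ σ' : Equiv.Perm ℕ) (τ τ' : ℕ → Equiv.Perm ℕ) {k : ℕ}
    (A : Formula k) :
    (A.rename σ τ).rename σ' τ' = A.rename (σ' * σ) (fun n => τ' n * τ n) := by
  induction A with
  | atom P args => simp only [Formula.rename, Term.rename_rename]
  | neg A ih => simp only [Formula.rename, ih]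
  | and A B ihA ihB => simp only [Formula.rename, ihA, ihB]
  | or A B ihA ihB => simp only [Formula.rename, ihA, ihB]
  | all A ih => simp only [Formula.rename, ih]
  | ex A ih => simp only [Formula.rename, ih]

theorem Term.hasVar_rename (σ : Equiv.Perm ℕ) (τ : ℕ → Equiv.Perm ℕ) {k : ℕ} (t : Term k) (x : ℕ) :
    (t.rename σ τ).HasVar x ↔ ∃ y, t.HasVar y ∧ σ y = x := by
  induction t with
  | var y => simp [Term.rename, Term.HasVar]
  | bvar i => simp [Term.rename, Term.HasVar]
  | app f args ih =>
    simp only [Term.rename, Term.HasVar]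
    constructor
    · rintro ⟨i, hi⟩
      obtain ⟨y, hy, rfl⟩ := (ih i).1 hi
      exact ⟨y, ⟨i, hy⟩, rfl⟩
    · rintro ⟨y, ⟨i, hy⟩, rfl⟩
      exact ⟨i, (ih i).2 ⟨y, hy, rfl⟩⟩

theorem Term.hasFunc_rename (σ : Equiv.Perm ℕ) (τ : ℕ → Equiv.Perm ℕ) {k : ℕ} (t : Term k)
    (g : FVar) :
    (t.rename σ τ).HasFunc g ↔ ∃ f, t.HasFunc f ∧ f.rename τ = g := by
  induction t with
  | var y => simp [Term.rename, Term.HasFunc]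
  | bvar i => simp [Term.rename, Term.HasFunc]
  | app f args ih =>
    simp only [Term.rename, Term.HasFunc]
    constructor
    · rintro (rfl | ⟨i, hi⟩)
      · exact ⟨f, Or.inl rfl, rfl⟩
      · obtain ⟨y, hy, rfl⟩ := (ih i).1 hi
        exact ⟨y, Or.inr ⟨i, hy⟩, rfl⟩
    · rintro ⟨y, rfl | ⟨i, hy⟩, rfl⟩
      · exact Or.inl rfl
      · exact Or.inr ⟨i, (ih i).2 ⟨y, hy, rfl⟩⟩

theorem Formula.hasVar_rename (σ : Equiv.Perm ℕ) (τ : ℕ → Equiv.Perm ℕ) (x : ℕ) {k : ℕ}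
    (A : Formula k) : (A.rename σ τ).HasVar x ↔ ∃ y, A.HasVar y ∧ σ y = x := by
  induction A with
  | atom P args =>
    simp only [Formula.rename, Formula.HasVar, Term.hasVar_rename]
    constructor
    · rintro ⟨i, y, h⟩; exact ⟨y, ⟨i, h.1⟩, h.2⟩
    · rintro ⟨y, ⟨i, h⟩, h'⟩; exact ⟨i, y, h, h'⟩
  | neg A ih => simpa only [Formula.rename, Formula.HasVar] using ih
  | and A B ihA ihB =>
    simp only [Formula.rename, Formula.HasVar, ihA, ihB, or_and_right, exists_or]
  | or A B ihA ihB =>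
    simp only [Formula.rename, Formula.HasVar, ihA, ihB, or_and_right, exists_or]
  | all A ih => simpa only [Formula.rename, Formula.HasVar] using ih
  | ex A ih => simpa only [Formula.rename, Formula.HasVar] using ih

theorem Formula.hasFunc_rename (σ : Equiv.Perm ℕ) (τ : ℕ → Equiv.Perm ℕ) (g : FVar) {k : ℕ}
    (A : Formula k) : (A.rename σ τ).HasFunc g ↔ ∃ f, A.HasFunc f ∧ f.rename τ = g := by
  induction A with
  | atom P args =>
    simp only [Formula.rename, Formula.HasFunc, Term.hasFunc_rename]
    constructor
    · rintro ⟨i, y, h⟩; exact ⟨y, ⟨i, h.1⟩, h.2⟩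
    · rintro ⟨y, ⟨i, h⟩, h'⟩; exact ⟨i, y, h, h'⟩
  | neg A ih => simpa only [Formula.rename, Formula.HasFunc] using ih
  | and A B ihA ihB =>
    simp only [Formula.rename, Formula.HasFunc, ihA, ihB, or_and_right, exists_or]
  | or A B ihA ihB =>
    simp only [Formula.rename, Formula.HasFunc, ihA, ihB, or_and_right, exists_or]
  | all A ih => simpa only [Formula.rename, Formula.HasFunc] using ih
  | ex A ih => simpa only [Formula.rename, Formula.HasFunc] using ih

theorem Mat.hasVar_rename (σ : Equiv.Perm ℕ) (τ : ℕ → Equiv.Perm ℕ) (x : ℕ) (M : Mat) :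
    (M.rename σ τ).HasVar x ↔ ∃ y, M.HasVar y ∧ σ y = x := by
  simp only [Mat.HasVar, Mat.rename, Finset.mem_image]
  constructor
  · rintro ⟨_, ⟨Γ, hΓ, rfl⟩, B, hB, h⟩
    obtain ⟨A, hA, rfl⟩ := Finset.mem_image.1 hB
    obtain ⟨y, hy, e⟩ := (Formula.hasVar_rename σ τ x A).1 h
    exact ⟨y, ⟨Γ, hΓ, A, hA, hy⟩, e⟩
  · rintro ⟨y, ⟨Γ, hΓ, A, hA, hy⟩, e⟩
    exact ⟨_, ⟨Γ, hΓ, rfl⟩, _, Finset.mem_image_of_mem _ hA,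
      (Formula.hasVar_rename σ τ x A).2 ⟨y, hy, e⟩⟩

theorem Mat.hasFunc_rename (σ : Equiv.Perm ℕ) (τ : ℕ → Equiv.Perm ℕ) (g : FVar) (M : Mat) :
    (M.rename σ τ).HasFunc g ↔ ∃ f, M.HasFunc f ∧ f.rename τ = g := by
  simp only [Mat.HasFunc, Mat.rename, Finset.mem_image]
  constructor
  · rintro ⟨_, ⟨Γ, hΓ, rfl⟩, B, hB, h⟩
    obtain ⟨A, hA, rfl⟩ := Finset.mem_image.1 hB
    obtain ⟨y, hy, e⟩ := (Formula.hasFunc_rename σ τ g A).1 h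
    exact ⟨y, ⟨Γ, hΓ, A, hA, hy⟩, e⟩
  · rintro ⟨y, ⟨Γ, hΓ, A, hA, hy⟩, e⟩
    exact ⟨_, ⟨Γ, hΓ, rfl⟩, _, Finset.mem_image_of_mem _ hA,
      (Formula.hasFunc_rename σ τ g A).2 ⟨y, hy, e⟩⟩

theorem Proto.rename_one (X : Proto) : X.rename 1 (fun _ => 1) = X := by
  obtain ⟨F, V, M⟩ := X
  have h1 : F.image (FVar.rename (fun _ => 1)) = F := by
    conv_rhs => rw [← Finset.image_id (s := F)]
    rfl
  have h2 : V.image (1 : Equiv.Perm ℕ) = V := by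
    conv_rhs => rw [← Finset.image_id (s := V)]
    rfl
  have h3 : (Formula.rename 1 (fun _ => 1) : Formula 0 → Formula 0) = id :=
    funext Formula.rename_one
  simp only [Proto.rename, Mat.rename, h1, h2, h3, Finset.image_id, Proto.mk.injEq, true_and]
  exact Finset.image_id

theorem Proto.rename_rename (σ σ' : Equiv.Perm ℕ) (τ τ' : ℕ → Equiv.Perm ℕ) (X : Proto) :
    (X.rename σ τ).rename σ' τ' = X.rename (σ' * σ) (fun n => τ' n * τ n) := by
  obtain ⟨F, V, M⟩ := X
  have h3 : (Formula.rename σ' τ' ∘ Formula.rename σ τ : Formula 0 → Formula 0) =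
      Formula.rename (σ' * σ) (fun n => τ' n * τ n) :=
    funext (Formula.rename_rename σ σ' τ τ')
  simp only [Proto.rename, Mat.rename, Finset.image_image, Proto.mk.injEq]
  refine ⟨rfl, rfl, ?_⟩
  congr 1
  funext Γ
  simp only [Function.comp, Finset.image_image]
  rw [← h3]

theorem Proto.similar_refl (X : Proto) : X.Similar X :=
  ⟨1, fun _ => 1, fun _ _ _ => rfl, fun _ _ _ => rfl, X.rename_one.symm⟩

theorem Proto.similar_trans {X Y Z : Proto} (h : X.Similar Y) (h' : Y.Similar Z) :
    X.Similar Z := by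
  obtain ⟨σ, τ, hσ, hτ, rfl⟩ := h
  obtain ⟨σ', τ', hσ', hτ', rfl⟩ := h'
  refine ⟨σ' * σ, fun n => τ' n * τ n, fun x hx hx' => ?_, fun f hf hf' => ?_,
    Proto.rename_rename ..⟩
  · have e := hσ x hx hx'
    have := hσ' x ((Mat.hasVar_rename σ τ x X.mat).2 ⟨x, hx, e⟩) (fun hm => by
      obtain ⟨y, hy, hyx⟩ := Finset.mem_image.1 hm
      exact hx' (by rwa [← σ.injective (hyx.trans e.symm)]))
    simp [Equiv.Perm.mul_apply, e, this]
  · have e := hτ f hf hf'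
    have := hτ' f ((Mat.hasFunc_rename σ τ f X.mat).2 ⟨f, hf, e⟩) (fun hm => by
      obtain ⟨y, hy, hyx⟩ := Finset.mem_image.1 hm
      exact hf' (by rwa [← FVar.rename_inj (hyx.trans e.symm)]))
    calc f.rename (fun n => τ' n * τ n) = (f.rename τ).rename τ' := rfl
      _ = f := by rw [e, this]

theorem Proto.similar_symm {X Y : Proto} (h : X.Similar Y) : Y.Similar X := by
  obtain ⟨σ, τ, hσ, hτ, rfl⟩ := h
  refine ⟨σ⁻¹, fun n => (τ n)⁻¹, fun x hx hx' => ?_, fun f hf hf' => ?_, ?_⟩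
  · obtain ⟨y, hy, rfl⟩ := (Mat.hasVar_rename σ τ x X.mat).1 hx
    have : y ∉ X.inds := fun hm => hx' (Finset.mem_image_of_mem _ hm)
    rw [hσ y hy this, Equiv.Perm.inv_eq_iff_eq, hσ y hy this]
  · obtain ⟨g, hg, rfl⟩ := (Mat.hasFunc_rename σ τ f X.mat).1 hf
    have : g ∉ X.funcs := fun hm => hf' (Finset.mem_image_of_mem _ hm)
    have e : (g.rename τ).rename (fun n => (τ n)⁻¹) = g := by simp [FVar.rename]
    rw [e, hτ g hg this]
  · rw [Proto.rename_rename]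
    simp only [inv_mul_cancel]
    exact X.rename_one.symm

instance Proto.setoid : Setoid Proto where
  r := Proto.Similar
  iseqv := ⟨Proto.similar_refl, Proto.similar_symm, Proto.similar_trans⟩

theorem Term.eval_rename {D : Type} (I J : Interp D) (σ : Equiv.Perm ℕ) (τ : ℕ → Equiv.Perm ℕ)
    {k : ℕ} (e : Fin k → D) (t : Term k) (hv : ∀ x, t.HasVar x → J.ind (σ x) = I.ind x)
    (hf : ∀ f, t.HasFunc f → J.func (f.rename τ) = I.func f) :
    (t.rename σ τ).eval J e = t.eval I e := by
  induction t with
  | var x => exact hv x rfl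
  | bvar i => rfl
  | app f args ih =>
    simp only [Term.rename, Term.eval]
    rw [hf f (Or.inl rfl)]
    congr 1
    funext i
    exact ih i (fun x hx => hv x ⟨i, hx⟩) (fun g hg => hf g (Or.inr ⟨i, hg⟩))

theorem Formula.holds_rename {D : Type} (I J : Interp D) (hp : J.pred = I.pred)
    (σ : Equiv.Perm ℕ) (τ : ℕ → Equiv.Perm ℕ)
    {k : ℕ} (A : Formula k) (e : Fin k → D) (hv : ∀ x, A.HasVar x → J.ind (σ x) = I.ind x)
    (hf : ∀ f, A.HasFunc f → J.func (f.rename τ) = I.func f) :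
    (A.rename σ τ).Holds J e ↔ A.Holds I e := by
  induction A with
  | atom P args =>
    simp only [Formula.rename, Formula.Holds, hp]
    have : (fun i => ((args i).rename σ τ).eval J e) = fun i => (args i).eval I e :=
      funext fun i => Term.eval_rename I J σ τ e (args i) (fun x hx => hv x ⟨i, hx⟩)
        (fun g hg => hf g ⟨i, hg⟩)
    rw [this]
  | neg A ih => exact not_congr (ih e hv hf)
  | and A B ihA ihB =>
    exact and_congr (ihA e (fun x h => hv x (Or.inl h)) (fun x h => hf x (Or.inl h)))
      (ihB e (fun x h => hv x (Or.inr h)) (fun x h => hf x (Or.inr h)))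
  | or A B ihA ihB =>
    exact or_congr (ihA e (fun x h => hv x (Or.inl h)) (fun x h => hf x (Or.inl h)))
      (ihB e (fun x h => hv x (Or.inr h)) (fun x h => hf x (Or.inr h)))
  | all A ih => exact forall_congr' fun d => ih (Fin.cons d e) hv hf
  | ex A ih => exact exists_congr fun d => ih (Fin.cons d e) hv hf

/-- Assignments to the functional variables of a prefix can be transported along a renaming. -/
theorem Proto.exists_func_rename {D : Type} (I : Interp D) {X : Proto} {σ : Equiv.Perm ℕ}
    {τ : ℕ → Equiv.Perm ℕ}
    (hτ : ∀ f, X.mat.HasFunc f → f ∉ X.funcs → f.rename τ = f)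
    (F : (f : FVar) → (Fin f.arity → D) → D) (hF : ∀ f, f ∉ X.funcs → F f = I.func f) :
    ∃ G : (f : FVar) → (Fin f.arity → D) → D,
      (∀ f, f ∉ (X.rename σ τ).funcs → G f = I.func f) ∧
      ∀ f, X.mat.HasFunc f → G (f.rename τ) = F f := by
  classical
  refine ⟨fun g => if g ∈ (X.rename σ τ).funcs then
      F ⟨g.arity, (τ g.arity)⁻¹ g.idx⟩ else I.func g, fun f hf => if_neg hf, ?_⟩
  rintro ⟨n, i⟩ hf
  by_cases hm : (⟨n, i⟩ : FVar) ∈ X.funcs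
  · have h1 : (⟨n, i⟩ : FVar).rename τ ∈ (X.rename σ τ).funcs := Finset.mem_image_of_mem _ hm
    have e : (τ n)⁻¹ (τ n i) = i := by simp
    have e' : F ⟨n, (τ n)⁻¹ (τ n i)⟩ = F ⟨n, i⟩ := by rw [e]
    exact (if_pos h1).trans e'
  · have e := hτ _ hf hm
    have h1 : (⟨n, i⟩ : FVar).rename τ ∉ (X.rename σ τ).funcs := fun hm' => by
      obtain ⟨y, hy, hyx⟩ := Finset.mem_image.1 hm'
      exact hm (by rwa [← FVar.rename_inj hyx])
    have e' : τ n i = i := by simpa [FVar.rename] using e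
    have e'' : I.func ⟨n, τ n i⟩ = I.func ⟨n, i⟩ := by rw [e']
    exact (if_neg h1).trans (e''.trans (hF _ hm).symm)

theorem Proto.verifiedAsDual_of_similar {D : Type} (I : Interp D) {X Y : Proto}
    (h : Y.Similar X) (hX : X.VerifiedAsDual I) : Y.VerifiedAsDual I := by
  obtain ⟨σ, τ, hσ, hτ, rfl⟩ := h
  intro F hF
  obtain ⟨G, hG, hGF⟩ := Proto.exists_func_rename I (σ := σ) hτ F hF
  obtain ⟨b, hb, h⟩ := hX G hG
  refine ⟨fun x => if x ∈ Y.inds then b (σ x) else I.ind x, fun x hx => if_neg hx,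
    fun Γ hΓ => ?_⟩
  obtain ⟨B, hB, hT⟩ := h _ (Finset.mem_image_of_mem _ hΓ)
  obtain ⟨A, hA, rfl⟩ := Finset.mem_image.1 hB
  refine ⟨A, hA, (Formula.holds_rename ⟨_, F, I.pred⟩ ⟨b, G, I.pred⟩ rfl σ τ A _ ?_ ?_).1 hT⟩
  · intro x hx
    by_cases hm : x ∈ Y.inds
    · simp [hm]
    · have e := hσ x ⟨Γ, hΓ, A, hA, hx⟩ hm
      simp only [hm, if_false, e]
      refine hb x fun hm' => ?_
      obtain ⟨y, hy, hyx⟩ := Finset.mem_image.1 hm'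
      exact hm (by rwa [← σ.injective (hyx.trans e.symm)])
  · exact fun f hf => hGF f ⟨Γ, hΓ, A, hA, hf⟩

theorem Proto.verifiedAsDatum_of_similar {D : Type} (I : Interp D) {X Y : Proto}
    (h : X.Similar Y) (hX : X.VerifiedAsDatum I) : Y.VerifiedAsDatum I := by
  obtain ⟨σ, τ, hσ, hτ, rfl⟩ := h
  obtain ⟨F, hF, hX⟩ := hX
  obtain ⟨G, hG, hGF⟩ := Proto.exists_func_rename I (σ := σ) hτ F hF
  refine ⟨G, hG, fun b hb => ?_⟩
  obtain ⟨Γ, hΓ, h⟩ := hX (fun x => if x ∈ X.inds then b (σ x) else I.ind x)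
    (fun x hx => if_neg hx)
  refine ⟨_, Finset.mem_image_of_mem _ hΓ, fun B hB => ?_⟩
  obtain ⟨A, hA, rfl⟩ := Finset.mem_image.1 hB
  refine (Formula.holds_rename ⟨_, F, I.pred⟩ ⟨b, G, I.pred⟩ rfl σ τ A _ ?_ ?_).2 (h A hA)
  · intro x hx
    by_cases hm : x ∈ X.inds
    · simp [hm]
    · have e := hσ x ⟨Γ, hΓ, A, hA, hx⟩ hm
      simp only [hm, if_false, e]
      refine hb x fun hm' => ?_
      obtain ⟨y, hy, hyx⟩ := Finset.mem_image.1 hm'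
      exact hm (by rwa [← σ.injective (hyx.trans e.symm)])
  · exact fun f hf => hGF f ⟨Γ, hΓ, A, hA, hf⟩

/-! ### Data and dual data -/

/-- Data: objects `(E f)(x): Γ / Δ / ...` up to renaming of bound variables. -/
def Datum : Type := Quotient Proto.setoid

/-- Dual data: objects `(f)(E x): Γ; Δ; ...` up to renaming of bound variables. -/
def DualDatum : Type := Quotient Proto.setoid

/-- The datum represented by a proto-datum. -/
def Proto.toDatum (X : Proto) : Datum := Quotient.mk Proto.setoid X

/-- The dual datum represented by a proto-datum. -/
def Proto.toDual (X : Proto) : DualDatum := Quotient.mk Proto.setoid X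

/-- The interpretation verifies the datum. -/
def Datum.Verified {D : Type} (I : Interp D) (α : Datum) : Prop :=
  Quotient.lift (fun X : Proto => X.VerifiedAsDatum I)
    (fun _ _ h => propext ⟨Proto.verifiedAsDatum_of_similar I h,
      Proto.verifiedAsDatum_of_similar I (Proto.similar_symm h)⟩) α

/-- The interpretation verifies the dual datum. -/
def DualDatum.Verified {D : Type} (I : Interp D) (δ : DualDatum) : Prop :=
  Quotient.lift (fun X : Proto => X.VerifiedAsDual I)
    (fun _ _ h => propext ⟨Proto.verifiedAsDual_of_similar I (Proto.similar_symm h),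
      Proto.verifiedAsDual_of_similar I h⟩) δ

/-- Semantic implication `α ⊨ δ`. -/
def Entails (α : Datum) (δ : DualDatum) : Prop :=
  ∀ (D : Type) (I : Interp D), α.Verified I → δ.Verified I

/-! ### Standard data -/

/-- Every functional term occurring in the given term is of the form `f(x₁, ..., xₙ)`, where
`x₁, ..., xₙ` (in this order) are the first `n` entries of the list. -/
def Term.InitialArgs {k : ℕ} (l : List ℕ) : Term k → Prop
  | .var _ => True
  | .bvar _ => True
  | .app f args => ∀ i : Fin f.arity, ∃ x : ℕ, l[(i : ℕ)]? = some x ∧ args i = .var x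

def Formula.InitialArgs (l : List ℕ) : {k : ℕ} → Formula k → Prop
  | _, .atom _ args => ∀ i, (args i).InitialArgs l
  | _, .neg A => A.InitialArgs l
  | _, .and A B => A.InitialArgs l ∧ B.InitialArgs l
  | _, .or A B => A.InitialArgs l ∧ B.InitialArgs l
  | _, .all A => A.InitialArgs l
  | _, .ex A => A.InitialArgs l

/-- All functional variables in the matrix appear in the prefix, they are applied to individual
variables only, and for some ordering of the individual prefix the arguments of every functional
term in the matrix form an initial segment of the ordering. -/
def Proto.Standard (X : Proto) : Prop :=
  (∀ f, X.mat.HasFunc f → f ∈ X.funcs) ∧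
  ∃ l : List ℕ, l.Nodup ∧ l.toFinset = X.inds ∧ ∀ Γ ∈ X.mat, ∀ A ∈ Γ, A.InitialArgs l

/-- A standard datum. (The property does not depend on the representative.) -/
def Datum.Standard (α : Datum) : Prop := ∃ X : Proto, X.toDatum = α ∧ X.Standard

/-- A standard dual datum. (The property does not depend on the representative.) -/
def DualDatum.Standard (δ : DualDatum) : Prop := ∃ X : Proto, X.toDual = δ ∧ X.Standard

/-! ### The rules of QDC and QDDC

In the rules, `F` and `V` are the functional and the individual prefix, `Γ` and `Δ` are components
and `ρ` is the rest of the matrix. All of these are finite sets, so `Γ, A` is `insert A Γ`. -/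

/-- The formula does not contain the variable `y` free, nor do `Γ` and `ρ`. -/
def FreshVar (y : ℕ) (A : Formula 1) (Γ : Comp) (ρ : Mat) : Prop :=
  ¬ A.HasVar y ∧ ¬ Mat.HasVar y (insert Γ ρ)

/-- The functional variable `g` does not occur in `A`, `Γ`, `ρ`. -/
def FreshFunc (g : FVar) (A : Formula 1) (Γ : Comp) (ρ : Mat) : Prop :=
  ¬ A.HasFunc g ∧ ¬ Mat.HasFunc g (insert Γ ρ)

/-- `x` lists the variables of the finite set `V`, without repetitions. -/
def Lists {n : ℕ} (x : Fin n → ℕ) (V : Finset ℕ) : Prop :=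
  Function.Injective x ∧ Finset.univ.image x = V

/-- The term `g(x₁, ..., xₙ)`, where `g` is the functional variable of arity `n` and index `j`. -/
def skolem {n : ℕ} (j : ℕ) (x : Fin n → ℕ) : Term 0 :=
  .app ⟨n, j⟩ (fun i => .var (x i))

/-- The substitution of `t` for `y`. -/
def single (y : ℕ) (t : Term 0) : ℕ → Term 0 := Function.update Term.var y t

/-- The G-rules for data, in the analytic direction. -/
inductive GData : Proto → Proto → Prop
  | and (F : Finset FVar) (V : Finset ℕ) (A B : Formula 0) (Γ : Comp) (ρ : Mat) :
      GData ⟨F, V, insert (insert (.and A B) Γ) ρ⟩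
      ⟨F, V, insert (insert A (insert B Γ)) ρ⟩
  | or (F : Finset FVar) (V : Finset ℕ) (A B : Formula 0) (Γ : Comp) (ρ : Mat) :
      GData ⟨F, V, insert (insert (.or A B) Γ) ρ⟩
      ⟨F, V, insert (insert A Γ) (insert (insert B Γ) ρ)⟩
  | negNeg (F : Finset FVar) (V : Finset ℕ) (A : Formula 0) (Γ : Comp) (ρ : Mat) :
      GData ⟨F, V, insert (insert (.neg (.neg A)) Γ) ρ⟩
      ⟨F, V, insert (insert A Γ) ρ⟩
  | negAnd (F : Finset FVar) (V : Finset ℕ) (A B : Formula 0) (Γ : Comp) (ρ : Mat) :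
      GData ⟨F, V, insert (insert (.neg (.and A B)) Γ) ρ⟩
      ⟨F, V, insert (insert (.neg A) Γ) (insert (insert (.neg B) Γ) ρ)⟩
  | negOr (F : Finset FVar) (V : Finset ℕ) (A B : Formula 0) (Γ : Comp) (ρ : Mat) :
      GData ⟨F, V, insert (insert (.neg (.or A B)) Γ) ρ⟩
      ⟨F, V, insert (insert (.neg A) (insert (.neg B) Γ)) ρ⟩
  | all (F : Finset FVar) (V : Finset ℕ) (A : Formula 1) (Γ : Comp) (ρ : Mat) (y : ℕ) :
      FreshVar y A Γ ρ →
      GData ⟨F, V, insert (insert (.all A) Γ) ρ⟩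
        ⟨F, insert y V, insert (insert (A.inst (.var y)) Γ) ρ⟩
  | negEx (F : Finset FVar) (V : Finset ℕ) (A : Formula 1) (Γ : Comp) (ρ : Mat) (y : ℕ) :
      FreshVar y A Γ ρ →
      GData ⟨F, V, insert (insert (.neg (.ex A)) Γ) ρ⟩
        ⟨F, insert y V, insert (insert (.neg (A.inst (.var y))) Γ) ρ⟩
  | ex (F : Finset FVar) (V : Finset ℕ) (A : Formula 1) (Γ : Comp) (ρ : Mat)
      (n j : ℕ) (x : Fin n → ℕ) :
      Lists x V → FreshFunc ⟨n, j⟩ A Γ ρ →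
      GData ⟨F, V, insert (insert (.ex A) Γ) ρ⟩
        ⟨insert ⟨n, j⟩ F, V, insert (insert (A.inst (skolem j x)) Γ) ρ⟩
  | negAll (F : Finset FVar) (V : Finset ℕ) (A : Formula 1) (Γ : Comp) (ρ : Mat)
      (n j : ℕ) (x : Fin n → ℕ) :
      Lists x V → FreshFunc ⟨n, j⟩ A Γ ρ →
      GData ⟨F, V, insert (insert (.neg (.all A)) Γ) ρ⟩
        ⟨insert ⟨n, j⟩ F, V, insert (insert (.neg (A.inst (skolem j x))) Γ) ρ⟩

/-- Inference by one application of a rule of QDC: from the first to the second. -/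
inductive RuleQDC : Proto → Proto → Prop
  /-- downward (analytic) G-rules -/
  | down {X Y} : GData X Y → RuleQDC X Y
  /-- upward (synthetic) G-rules -/
  | up {X Y} : GData X Y → RuleQDC Y X
  /-- Non-Contradiction -/
  | nc (F : Finset FVar) (V : Finset ℕ) (A : Formula 0) (Γ : Comp) (ρ : Mat) :
      RuleQDC ⟨F, V, insert (insert A (insert (.neg A) Γ)) ρ⟩ ⟨F, V, ρ⟩
  /-- Excluded Middle -/
  | em (F : Finset FVar) (V : Finset ℕ) (A : Formula 0) (Γ : Comp) (ρ : Mat) :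
      RuleQDC ⟨F, V, insert Γ ρ⟩
      ⟨F, V, insert (insert A Γ) (insert (insert (.neg A) Γ) ρ)⟩
  /-- Deletion -/
  | del (F : Finset FVar) (V : Finset ℕ) (Γ Δ : Comp) (ρ : Mat) :
      RuleQDC ⟨F, V, insert (Γ ∪ Δ) ρ⟩ ⟨F, V, insert Γ ρ⟩
  /-- Expansion -/
  | exp (F : Finset FVar) (V : Finset ℕ) (Γ : Comp) (ρ : Mat) : RuleQDC ⟨F, V, ρ⟩ ⟨F, V, insert Γ ρ⟩
  /-- Instantiation: from `(Ef)(x, y): α(y)` infer `(Ef)(x): α(t)` -/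
  | inst (F : Finset FVar) (V : Finset ℕ) (M : Mat) (y : ℕ) (t : Term 0) :
      RuleQDC ⟨F, insert y V, M⟩ ⟨F, V, M.subst (single y t)⟩
  /-- Generalization: from `(Ef)(x): α(t)` infer `(Ef, g)(x): α(gx)`, where `g` is not in `α( )`;
  the variable `z` marks the places of `t` and `gx` -/
  | gen (F : Finset FVar) (V : Finset ℕ) (M : Mat) (z : ℕ) (t : Term 0) (n j : ℕ) (x : Fin n → ℕ) :
      Lists x V →
      ¬ M.HasFunc ⟨n, j⟩ →
      RuleQDC ⟨F, V, M.subst (single z t)⟩ ⟨insert ⟨n, j⟩ F, V, M.subst (single z (skolem j x))⟩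
  /-- Elimination of Vacuous Existential variables -/
  | eve (F : Finset FVar) (V : Finset ℕ) (M : Mat) (g : FVar) :
      ¬ M.HasFunc g → RuleQDC ⟨insert g F, V, M⟩ ⟨F, V, M⟩
  /-- Introduction of Vacuous Universal variables -/
  | ivu (F : Finset FVar) (V : Finset ℕ) (M : Mat) (y : ℕ) :
      ¬ M.HasVar y → RuleQDC ⟨F, V, M⟩ ⟨F, insert y V, M⟩

/-- The G-rules for dual data, in the analytic direction. -/
inductive GDual : Proto → Proto → Prop
  | or (F : Finset FVar) (V : Finset ℕ) (A B : Formula 0) (Γ : Comp) (ρ : Mat) :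
      GDual ⟨F, V, insert (insert (.or A B) Γ) ρ⟩
      ⟨F, V, insert (insert A (insert B Γ)) ρ⟩
  | and (F : Finset FVar) (V : Finset ℕ) (A B : Formula 0) (Γ : Comp) (ρ : Mat) :
      GDual ⟨F, V, insert (insert (.and A B) Γ) ρ⟩
      ⟨F, V, insert (insert A Γ) (insert (insert B Γ) ρ)⟩
  | negNeg (F : Finset FVar) (V : Finset ℕ) (A : Formula 0) (Γ : Comp) (ρ : Mat) :
      GDual ⟨F, V, insert (insert (.neg (.neg A)) Γ) ρ⟩
      ⟨F, V, insert (insert A Γ) ρ⟩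
  | negOr (F : Finset FVar) (V : Finset ℕ) (A B : Formula 0) (Γ : Comp) (ρ : Mat) :
      GDual ⟨F, V, insert (insert (.neg (.or A B)) Γ) ρ⟩
      ⟨F, V, insert (insert (.neg A) Γ) (insert (insert (.neg B) Γ) ρ)⟩
  | negAnd (F : Finset FVar) (V : Finset ℕ) (A B : Formula 0) (Γ : Comp) (ρ : Mat) :
      GDual ⟨F, V, insert (insert (.neg (.and A B)) Γ) ρ⟩
      ⟨F, V, insert (insert (.neg A) (insert (.neg B) Γ)) ρ⟩
  | ex (F : Finset FVar) (V : Finset ℕ) (A : Formula 1) (Γ : Comp) (ρ : Mat) (y : ℕ) :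
      FreshVar y A Γ ρ →
      GDual ⟨F, V, insert (insert (.ex A) Γ) ρ⟩
        ⟨F, insert y V, insert (insert (A.inst (.var y)) Γ) ρ⟩
  | negAll (F : Finset FVar) (V : Finset ℕ) (A : Formula 1) (Γ : Comp) (ρ : Mat) (y : ℕ) :
      FreshVar y A Γ ρ →
      GDual ⟨F, V, insert (insert (.neg (.all A)) Γ) ρ⟩
        ⟨F, insert y V, insert (insert (.neg (A.inst (.var y))) Γ) ρ⟩
  | all (F : Finset FVar) (V : Finset ℕ) (A : Formula 1) (Γ : Comp) (ρ : Mat)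
      (n j : ℕ) (x : Fin n → ℕ) :
      Lists x V → FreshFunc ⟨n, j⟩ A Γ ρ →
      GDual ⟨F, V, insert (insert (.all A) Γ) ρ⟩
        ⟨insert ⟨n, j⟩ F, V, insert (insert (A.inst (skolem j x)) Γ) ρ⟩
  | negEx (F : Finset FVar) (V : Finset ℕ) (A : Formula 1) (Γ : Comp) (ρ : Mat)
      (n j : ℕ) (x : Fin n → ℕ) :
      Lists x V → FreshFunc ⟨n, j⟩ A Γ ρ →
      GDual ⟨F, V, insert (insert (.neg (.ex A)) Γ) ρ⟩
        ⟨insert ⟨n, j⟩ F, V, insert (insert (.neg (A.inst (skolem j x))) Γ) ρ⟩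

/-- Inference by one application of a rule of QDDC: from the first to the second. -/
inductive RuleQDDC : Proto → Proto → Prop
  /-- downward (analytic) G-rules -/
  | down {X Y} : GDual X Y → RuleQDDC X Y
  /-- upward (synthetic) G-rules -/
  | up {X Y} : GDual X Y → RuleQDDC Y X
  /-- Excluded Middle -/
  | em (F : Finset FVar) (V : Finset ℕ) (A : Formula 0) (Γ : Comp) (ρ : Mat) :
      RuleQDDC ⟨F, V, ρ⟩ ⟨F, V, insert (insert A (insert (.neg A) Γ)) ρ⟩
  /-- Non-Contradiction -/
  | nc (F : Finset FVar) (V : Finset ℕ) (A : Formula 0) (Γ : Comp) (ρ : Mat) :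
      RuleQDDC ⟨F, V, insert (insert A Γ) (insert (insert (.neg A) Γ) ρ)⟩
      ⟨F, V, insert Γ ρ⟩
  /-- Expansion -/
  | exp (F : Finset FVar) (V : Finset ℕ) (Γ Δ : Comp) (ρ : Mat) :
      RuleQDDC ⟨F, V, insert Γ ρ⟩ ⟨F, V, insert (Γ ∪ Δ) ρ⟩
  /-- Deletion -/
  | del (F : Finset FVar) (V : Finset ℕ) (Γ : Comp) (ρ : Mat) :
      RuleQDDC ⟨F, V, insert Γ ρ⟩ ⟨F, V, ρ⟩
  /-- Generalization: from `(f)(Ex): δ(t)` infer `(f)(Ex, y): δ(y)` -/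
  | gen (F : Finset FVar) (V : Finset ℕ) (M : Mat) (y : ℕ) (t : Term 0) :
      RuleQDDC ⟨F, V, M.subst (single y t)⟩ ⟨F, insert y V, M⟩
  /-- Instantiation: from `(f, g)(Ex): δ(gx)` infer `(f)(Ex): δ(t)`, where `g` is not in `δ( )`;
  the variable `z` marks the places of `gx` and `t` -/
  | inst (F : Finset FVar) (V : Finset ℕ) (M : Mat) (z : ℕ) (t : Term 0)
      (n j : ℕ) (x : Fin n → ℕ) :
      Lists x V →
      ¬ M.HasFunc ⟨n, j⟩ →
      RuleQDDC ⟨insert ⟨n, j⟩ F, V, M.subst (single z (skolem j x))⟩ ⟨F, V, M.subst (single z t)⟩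
  /-- Introduction of Vacuous Universal (functional) variables -/
  | ivu (F : Finset FVar) (V : Finset ℕ) (M : Mat) (g : FVar) :
      ¬ M.HasFunc g → RuleQDDC ⟨F, V, M⟩ ⟨insert g F, V, M⟩
  /-- Elimination of Vacuous Existential (individual) variables -/
  | eve (F : Finset FVar) (V : Finset ℕ) (M : Mat) (y : ℕ) :
      ¬ M.HasVar y → RuleQDDC ⟨F, insert y V, M⟩ ⟨F, V, M⟩

/-! ### The Criss-Crossing rule -/

/-- A component is pure if it does not contain a pair of contradictory formulas `A`, `¬A`. -/
def Pure (Γ : Comp) : Prop := ∀ A ∈ Γ, Formula.neg A ∉ Γ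

/-- Every pure component of the first matrix has a formula in common with every pure component of
the second one. -/
def WeaklyCrissCrosses (M N : Mat) : Prop :=
  ∀ Γ ∈ M, Pure Γ → ∀ Δ ∈ N, Pure Δ → ∃ A, A ∈ Γ ∧ A ∈ Δ

/-- `M` is an instance of `X`: the prefix is dropped and terms are uniformly substituted for
the individual variables of the prefix. -/
def Proto.HasInstance (X : Proto) (M : Mat) : Prop :=
  ∃ s : ℕ → Term 0, (∀ x, x ∉ X.inds → s x = .var x) ∧ M = X.mat.subst s

/-- The Criss-Crossing rule, from `X` qua datum to `Y` qua dual datum. The representatives are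
chosen such that the functional variables bound by the prefix of one do not occur in the matrix
of the other. -/
def RuleCrCr (X Y : Proto) : Prop :=
  (∀ f ∈ X.funcs, ¬ Y.mat.HasFunc f) ∧ (∀ g ∈ Y.funcs, ¬ X.mat.HasFunc g) ∧
  ∃ M N : Mat, X.HasInstance M ∧ Y.HasInstance N ∧ WeaklyCrissCrosses M N

/-! ### Deductions -/

/-- One step of a QDC-deduction. -/
def StepQDC (α β : Datum) : Prop :=
  ∃ X Y : Proto, X.toDatum = α ∧ Y.toDatum = β ∧ RuleQDC X Y

/-- One step of a QDDC-deduction. -/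
def StepQDDC (δ ε : DualDatum) : Prop :=
  ∃ X Y : Proto, X.toDual = δ ∧ Y.toDual = ε ∧ RuleQDDC X Y

/-- The transition step of a QHC-deduction. -/
def StepCrCr (β : Datum) (ε : DualDatum) : Prop :=
  ∃ X Y : Proto, X.toDatum = β ∧ Y.toDual = ε ∧ RuleCrCr X Y

/-- `α ⊢ δ` in QHC: there is a sequence consisting of a QDC-deduction from `α` to some datum `β`
followed by a QDDC-deduction from some dual datum `ε` to `δ`, where `ε` is inferable from `β` by
Criss-Crossing. -/
def Deducible (α : Datum) (δ : DualDatum) : Prop :=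
  ∃ (β : Datum) (ε : DualDatum), Relation.ReflTransGen StepQDC α β ∧ StepCrCr β ε ∧
    Relation.ReflTransGen StepQDDC ε δ

end QHC

namespace QHC

/-! ### Substitution and evaluation -/

/-! A standard datum is semantically a single first-order formula, and so is a standard dual datum.
Once both are reduced to formulas, what remains is the completeness of first-order logic, carried
out inside QDC.

Reduction. By standardness, a functional variable whose arity is the number of prefix variables is
applied only to the full list of them, in order. It is therefore a Skolem function, and the upward
existential rule replaces it by a quantifier. When all such functional variables are gone, the last
prefix variable is no longer an argument of any functional term and can be quantified universally.
Iterating this removes the whole prefix (`fold_funcs`, `fold_prefix`), after the matrix has been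
condensed to one formula (`fold_mat`). The steps used (`Fold`) preserve verification from conclusion
to premiss (`Fold.verified`), and their duals, read backwards, are rules of QDDC (`Fold.rule_dual`).
So the datum leads to a formula `A` that entails it. Applied to the dual of the dual datum, the same
procedure yields a formula `B` such that `B.dual` leads to the dual datum. If `B.dual` failed in an
interpretation, `B` would hold under the complementary predicates and the dual datum would fail
there too; hence `A` entails `B.dual`.

Completeness. Excluded Middle splits `A` into `A, B.dual / A, ¬B.dual`. The second component is
unsatisfiable, and a Henkin construction shows that every unsatisfiable component can be removed
(`Refutable.of_unsatisfiable`). Deletion leaves `B.dual`, which criss-crosses with itself. -/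

theorem Term.bind_congr {m n : ℕ} {s s' : ℕ → Term n} {b b' : Fin m → Term n} (t : Term m)
    (hs : ∀ x, t.HasVar x → s x = s' x) (hb : ∀ i, b i = b' i) : t.bind s b = t.bind s' b' := by
  induction t with
  | var x => exact hs x rfl
  | bvar i => exact hb i
  | app f args ih =>
    simp only [Term.bind]
    congr 1
    funext i
    exact ih i fun x hx => hs x ⟨i, hx⟩

theorem Formula.bind_congr {m : ℕ} (A : Formula m) : ∀ {n : ℕ} {s s' : ℕ → Term n}
    {b b' : Fin m → Term n}, (∀ x, A.HasVar x → s x = s' x) → (∀ i, b i = b' i) →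
    A.bind s b = A.bind s' b' := by
  induction A with
  | atom P args =>
    intro n s s' b b' hs hb
    simp only [Formula.bind]
    congr 1
    funext i
    exact Term.bind_congr _ (fun x hx => hs x ⟨i, hx⟩) hb
  | neg A ih =>
    intro n s s' b b' hs hb
    exact congrArg Formula.neg (ih hs hb)
  | and A B ihA ihB =>
    intro n s s' b b' hs hb
    exact congrArg₂ Formula.and (ihA (fun x h => hs x (Or.inl h)) hb)
      (ihB (fun x h => hs x (Or.inr h)) hb)
  | or A B ihA ihB =>
    intro n s s' b b' hs hb
    exact congrArg₂ Formula.or (ihA (fun x h => hs x (Or.inl h)) hb)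
      (ihB (fun x h => hs x (Or.inr h)) hb)
  | all A ih =>
    intro n s s' b b' hs hb
    refine congrArg Formula.all (ih (fun x h => by rw [hs x h]) fun i => ?_)
    cases i using Fin.cases with
    | zero => rfl
    | succ i => simp [hb i]
  | ex A ih =>
    intro n s s' b b' hs hb
    refine congrArg Formula.ex (ih (fun x h => by rw [hs x h]) fun i => ?_)
    cases i using Fin.cases with
    | zero => rfl
    | succ i => simp [hb i]

theorem Term.bind_bind {l m n : ℕ} (s : ℕ → Term m) (b : Fin l → Term m) (s' : ℕ → Term n)
    (b' : Fin m → Term n) (t : Term l) :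
    (t.bind s b).bind s' b' = t.bind (fun x => (s x).bind s' b') (fun i => (b i).bind s' b') := by
  induction t with
  | var x => rfl
  | bvar i => rfl
  | app f args ih =>
    simp only [Term.bind]
    congr 1
    funext i
    exact ih i

theorem Term.bind_id {k : ℕ} (t : Term k) : t.bind Term.var Term.bvar = t := by
  induction t with
  | var x => rfl
  | bvar i => rfl
  | app f args ih =>
    simp only [Term.bind]
    congr 1
    funext i
    exact ih i

/-- This is the quantifier case of composing substitutions. The lifted substitution acts on a lifted
term without touching the new index `0`. -/
theorem Term.lift_bind {m n : ℕ} (s : ℕ → Term n) (b : Fin m → Term n) (t : Term m) :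
    t.lift.bind (fun x => (s x).lift)
      (Fin.cases (motive := fun _ => Term (n + 1)) (.bvar 0) fun i => (b i).lift) =
    (t.bind s b).lift := by
  rw [Term.lift, Term.lift, Term.bind_bind, Term.bind_bind]
  rfl

theorem Formula.bind_bind {l : ℕ} (A : Formula l) : ∀ {m n : ℕ} (s : ℕ → Term m)
    (b : Fin l → Term m) (s' : ℕ → Term n) (b' : Fin m → Term n),
    (A.bind s b).bind s' b' = A.bind (fun x => (s x).bind s' b') (fun i => (b i).bind s' b') := by
  induction A with
  | atom P args =>
    intro m n s b s' b'
    simp only [Formula.bind]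
    congr 1
    funext i
    exact Term.bind_bind ..
  | neg A ih => intro m n s b s' b'; exact congrArg Formula.neg (ih ..)
  | and A B ihA ihB => intro m n s b s' b'; exact congrArg₂ Formula.and (ihA ..) (ihB ..)
  | or A B ihA ihB => intro m n s b s' b'; exact congrArg₂ Formula.or (ihA ..) (ihB ..)
  | all A ih =>
    intro m n s b s' b'
    refine congrArg Formula.all ((ih ..).trans
      (Formula.bind_congr A (fun x _ => Term.lift_bind ..) fun i => ?_))
    cases i using Fin.cases with
    | zero => rfl
    | succ i => exact Term.lift_bind ..
  | ex A ih =>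
    intro m n s b s' b'
    refine congrArg Formula.ex ((ih ..).trans
      (Formula.bind_congr A (fun x _ => Term.lift_bind ..) fun i => ?_))
    cases i using Fin.cases with
    | zero => rfl
    | succ i => exact Term.lift_bind ..

theorem Formula.bind_id {k : ℕ} (A : Formula k) : A.bind Term.var Term.bvar = A := by
  have key : ∀ {k : ℕ}, (fun i => Fin.cases (motive := fun _ => Term (k + 1)) (.bvar 0)
      (fun i => (Term.bvar i : Term k).lift) i) = Term.bvar := by
    intro k
    funext i
    cases i using Fin.cases with
    | zero => rfl
    | succ i => rfl
  induction A with
  | atom P args => simp only [Formula.bind, Term.bind_id]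
  | neg A ih => simp only [Formula.bind, ih]
  | and A B ihA ihB => simp only [Formula.bind, ihA, ihB]
  | or A B ihA ihB => simp only [Formula.bind, ihA, ihB]
  | all A ih =>
    refine congrArg Formula.all (Eq.trans ?_ ih)
    exact Formula.bind_congr A (fun _ _ => rfl) (congrFun key)
  | ex A ih =>
    refine congrArg Formula.ex (Eq.trans ?_ ih)
    exact Formula.bind_congr A (fun _ _ => rfl) (congrFun key)

theorem Formula.subst_eq_self {s : ℕ → Term 0} {A : Formula 0}
    (h : ∀ x, A.HasVar x → s x = .var x) : A.subst s = A :=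
  (Formula.bind_congr A h fun i => i.elim0).trans A.bind_id

theorem Formula.subst_inst_var {A : Formula 1} {y : ℕ} (h : ¬ A.HasVar y) (t : Term 0) :
    (A.inst (.var y)).subst (single y t) = A.inst t := by
  rw [Formula.subst, Formula.inst, Formula.bind_bind]
  refine Formula.bind_congr A (fun x hx => ?_) fun _ => ?_
  · have : x ≠ y := fun e => h (e ▸ hx)
    simp [Term.bind, single, this]
  · simp [Term.bind, single]

/-- The terms `e i` contain no indices, so lifting them and then filling the new index gives them
back. The quantifier cases of the truth lemma rest on this. -/
theorem Formula.bind_all_inst {k : ℕ} (A : Formula (k + 1)) (e : Fin k → Term 0) (t : Term 0) :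
    (A.bind (fun x => (Term.var x : Term 0).lift)
      (Fin.cases (motive := fun _ => Term 1) (.bvar 0) fun i => (e i).lift)).inst t =
    A.bind Term.var (Fin.cons t e : Fin (k + 1) → Term 0) := by
  rw [Formula.inst, Formula.bind_bind]
  refine Formula.bind_congr A (fun _ _ => rfl) fun i => ?_
  cases i using Fin.cases with
  | zero => rfl
  | succ i =>
    simp only [Fin.cases_succ, Fin.cons_succ, Term.lift, Term.bind_bind]
    refine (Term.bind_congr _ (fun _ _ => rfl) fun i => i.elim0).trans (Term.bind_id _)

/-! ### Semantics of substitution -/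

theorem Term.eval_bind {D : Type} (I : Interp D) {m n : ℕ} (s : ℕ → Term n) (b : Fin m → Term n)
    (e : Fin n → D) (t : Term m) :
    (t.bind s b).eval I e =
      t.eval ⟨fun x => (s x).eval I e, I.func, I.pred⟩ (fun i => (b i).eval I e) := by
  induction t with
  | var x => rfl
  | bvar i => rfl
  | app f args ih => simp only [Term.bind, Term.eval, ih]

theorem Term.eval_lift {D : Type} (I : Interp D) {k : ℕ} (e : Fin k → D) (d : D) (t : Term k) :
    t.lift.eval I (Fin.cons d e : Fin (k + 1) → D) = t.eval I e := by
  rw [Term.lift, Term.eval_bind]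
  rfl

theorem Formula.holds_bind {D : Type} {m : ℕ} (A : Formula m) :
    ∀ (I : Interp D) {n : ℕ} (s : ℕ → Term n) (b : Fin m → Term n) (e : Fin n → D),
    (A.bind s b).Holds I e ↔
      A.Holds ⟨fun x => (s x).eval I e, I.func, I.pred⟩ (fun i => (b i).eval I e) := by
  have key : ∀ (I : Interp D) {m n : ℕ} (b : Fin m → Term n) (e : Fin n → D) (d : D),
      (fun i => (Fin.cases (motive := fun _ => Term (n + 1)) (.bvar 0)
        (fun i => (b i).lift) i).eval I (Fin.cons d e : Fin (n + 1) → D)) =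
      (Fin.cons d fun i => (b i).eval I e : Fin (m + 1) → D) := by
    intro I m n b e d
    funext i
    cases i using Fin.cases with
    | zero => rfl
    | succ i => exact Term.eval_lift ..
  induction A with
  | atom P args => intro I n s b e; simp only [Formula.bind, Formula.Holds, Term.eval_bind]
  | neg A ih => intro I n s b e; exact not_congr (ih ..)
  | and A B ihA ihB => intro I n s b e; exact and_congr (ihA ..) (ihB ..)
  | or A B ihA ihB => intro I n s b e; exact or_congr (ihA ..) (ihB ..)
  | all A ih =>
    intro I n s b e
    refine forall_congr' fun d => (ih ..).trans ?_
    rw [key]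
    simp only [Term.eval_lift]
  | ex A ih =>
    intro I n s b e
    refine exists_congr fun d => (ih ..).trans ?_
    rw [key]
    simp only [Term.eval_lift]

theorem Formula.isTrue_inst {D : Type} (I : Interp D) (A : Formula 1) (t : Term 0) :
    (A.inst t).IsTrue I ↔ A.Holds I (Fin.cons (t.eval I Fin.elim0) Fin.elim0) := by
  rw [Formula.IsTrue, Formula.inst, Formula.holds_bind]
  have : (fun _ : Fin 1 => t.eval I Fin.elim0) = Fin.cons (t.eval I Fin.elim0) Fin.elim0 := by
    funext i
    rw [Subsingleton.elim i 0]
    rfl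
  rw [this]
  rfl

theorem Formula.holds_congr {D : Type} (I J : Interp D) (hp : J.pred = I.pred) {k : ℕ}
    (A : Formula k) (e : Fin k → D) (hv : ∀ x, A.HasVar x → J.ind x = I.ind x)
    (hf : ∀ f, A.HasFunc f → J.func f = I.func f) : A.Holds J e ↔ A.Holds I e := by
  have := Formula.holds_rename I J hp 1 (fun _ => 1) A e hv hf
  rwa [Formula.rename_one] at this

/-! ### Duality -/

/-- Interchange of conjunction with disjunction and of the quantifiers. -/
def Formula.dual : {k : ℕ} → Formula k → Formula k
  | _, .atom P args => .atom P args
  | _, .neg A => .neg A.dual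
  | _, .and A B => .or A.dual B.dual
  | _, .or A B => .and A.dual B.dual
  | _, .all A => .ex A.dual
  | _, .ex A => .all A.dual

theorem Formula.dual_dual {k : ℕ} (A : Formula k) : A.dual.dual = A := by
  induction A <;> simp_all [Formula.dual]

theorem Formula.dual_bind {m : ℕ} (A : Formula m) : ∀ {n : ℕ} (s : ℕ → Term n)
    (b : Fin m → Term n), (A.bind s b).dual = A.dual.bind s b := by
  induction A <;> intros <;> simp_all [Formula.dual, Formula.bind]

theorem Formula.dual_inst (A : Formula 1) (t : Term 0) : (A.inst t).dual = A.dual.inst t :=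
  A.dual_bind ..

theorem Formula.hasVar_dual {k : ℕ} (x : ℕ) (A : Formula k) : A.dual.HasVar x ↔ A.HasVar x := by
  induction A <;> simp_all [Formula.dual, Formula.HasVar]

theorem Formula.hasFunc_dual {k : ℕ} (g : FVar) (A : Formula k) :
    A.dual.HasFunc g ↔ A.HasFunc g := by
  induction A <;> simp_all [Formula.dual, Formula.HasFunc]

theorem Formula.initialArgs_dual {k : ℕ} {l : List ℕ} {A : Formula k} (h : A.InitialArgs l) :
    A.dual.InitialArgs l := by
  induction A <;> simp_all [Formula.dual, Formula.InitialArgs]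

/-- De Morgan's laws. Since `dual` leaves negations in place, the change of truth value has to start
at the atoms, where `J` complements the predicates of `I`. -/
theorem Formula.holds_dual {D : Type} {I J : Interp D} (hi : J.ind = I.ind)
    (hf : J.func = I.func) (hp : ∀ P v, J.pred P v ↔ ¬ I.pred P v) {k : ℕ} (A : Formula k)
    (e : Fin k → D) : A.dual.Holds J e ↔ ¬ A.Holds I e := by
  have key : ∀ {k : ℕ} (e : Fin k → D) (t : Term k), t.eval J e = t.eval I e := by
    intro k e t
    induction t with
    | var x => exact congrFun hi x
    | bvar i => rfl
    | app f args ih => simp only [Term.eval, ih, hf]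
  induction A with
  | atom P args => simp only [Formula.dual, Formula.Holds, hp, key]
  | neg A ih => exact not_congr (ih e)
  | and A B ihA ihB => simp only [Formula.dual, Formula.Holds, ihA, ihB, not_and_or]
  | or A B ihA ihB => simp only [Formula.dual, Formula.Holds, ihA, ihB, not_or]
  | all A ih => simp only [Formula.dual, Formula.Holds, ih, not_forall]
  | ex A ih => simp only [Formula.dual, Formula.Holds, ih, not_exists]

noncomputable def Comp.dual (Γ : Comp) : Comp := Γ.image Formula.dual

noncomputable def Mat.dual (M : Mat) : Mat := M.image Comp.dual

/-- The prefix stays as it is: its quantifiers are already interchanged when the same material is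
read as a dual datum. -/
noncomputable def Proto.dual (X : Proto) : Proto := ⟨X.funcs, X.inds, X.mat.dual⟩

theorem Comp.dual_insert (A : Formula 0) (Γ : Comp) :
    Comp.dual (insert A Γ) = insert A.dual (Comp.dual Γ) := Finset.image_insert ..

theorem Mat.dual_insert (Γ : Comp) (M : Mat) :
    Mat.dual (insert Γ M) = insert Γ.dual (Mat.dual M) := Finset.image_insert ..

theorem Proto.dual_dual (X : Proto) : X.dual.dual = X := by
  have h1 : Formula.dual ∘ Formula.dual = (id : Formula 0 → Formula 0) :=
    funext Formula.dual_dual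
  have h2 : Comp.dual ∘ Comp.dual = id := by
    funext Γ
    simp [Comp.dual, Finset.image_image, h1]
  obtain ⟨F, V, M⟩ := X
  simp [Proto.dual, Mat.dual, Finset.image_image, h2]

theorem Mat.hasFunc_dual (g : FVar) (M : Mat) : M.dual.HasFunc g ↔ M.HasFunc g := by
  simp [Mat.HasFunc, Mat.dual, Comp.dual, Formula.hasFunc_dual]

theorem Proto.Standard.dual {X : Proto} (h : X.Standard) : X.dual.Standard := by
  obtain ⟨h1, l, hl, hl', h2⟩ := h
  refine ⟨fun f hf => h1 f ((Mat.hasFunc_dual f _).1 hf), l, hl, hl', fun Γ hΓ A hA => ?_⟩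
  obtain ⟨Γ', hΓ', rfl⟩ := Finset.mem_image.1 hΓ
  obtain ⟨A', hA', rfl⟩ := Finset.mem_image.1 hA
  exact Formula.initialArgs_dual (h2 Γ' hΓ' A' hA')

/-- The values of the functional variables that verify the dualized datum are a counterexample to
the dual datum: whatever the individual values, some component has only false formulas. -/
theorem Proto.not_verifiedAsDual {D : Type} {I : Interp D} {X : Proto}
    (h : X.dual.VerifiedAsDatum ⟨I.ind, I.func, fun P v => ¬ I.pred P v⟩) :
    ¬ X.VerifiedAsDual I := by
  intro h'
  obtain ⟨F, hF, h⟩ := h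
  obtain ⟨a, ha, h'⟩ := h' F hF
  obtain ⟨Γ, hΓ, h⟩ := h a ha
  obtain ⟨Γ', hΓ', rfl⟩ := Finset.mem_image.1 hΓ
  obtain ⟨A, hA, hT⟩ := h' Γ' hΓ'
  exact (Formula.holds_dual (I := ⟨a, F, I.pred⟩) (J := ⟨a, F, fun P v => ¬ I.pred P v⟩) rfl rfl
    (fun _ _ => Iff.rfl) A _).1 (h _ (Finset.mem_image_of_mem _ hA)) hT

/-! ### Folding the prefix of a datum into its matrix -/

/-- A propositional variable, used to express truth and falsity. -/
def propVar : Formula 0 := .atom ⟨0, 0⟩ Fin.elim0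

/-- The synthetic rules that turn a standard datum into a single formula. Each of them is
reversible semantically, and its dual is a rule for dual data. -/
inductive Fold : Proto → Proto → Prop
  | and (F : Finset FVar) (V : Finset ℕ) (A B : Formula 0) (Γ : Comp) (ρ : Mat) :
      Fold ⟨F, V, insert (insert A (insert B Γ)) ρ⟩ ⟨F, V, insert (insert (.and A B) Γ) ρ⟩
  | or (F : Finset FVar) (V : Finset ℕ) (A B : Formula 0) (Γ : Comp) (ρ : Mat) :
      Fold ⟨F, V, insert (insert A Γ) (insert (insert B Γ) ρ)⟩
        ⟨F, V, insert (insert (.or A B) Γ) ρ⟩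
  | em (F : Finset FVar) (V : Finset ℕ) (A : Formula 0) (Γ : Comp) (ρ : Mat) :
      Fold ⟨F, V, insert Γ ρ⟩ ⟨F, V, insert (insert A Γ) (insert (insert (.neg A) Γ) ρ)⟩
  -- Expansion is admitted only with a contradictory component, since otherwise the conclusion would
  -- not imply the premiss.
  | absurd (F : Finset FVar) (V : Finset ℕ) (A : Formula 0) (ρ : Mat) :
      Fold ⟨F, V, ρ⟩ ⟨F, V, insert {.and A (.neg A)} ρ⟩
  -- The quantifier steps are needed only when the matrix is a single formula, so that freshness
  -- concerns `A` alone.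
  | all (F : Finset FVar) (V : Finset ℕ) (A : Formula 1) (y : ℕ) : ¬ A.HasVar y →
      Fold ⟨F, insert y V, {{A.inst (.var y)}}⟩ ⟨F, V, {{.all A}}⟩
  | ex (F : Finset FVar) (V : Finset ℕ) (A : Formula 1) (n j : ℕ) (x : Fin n → ℕ) :
      Lists x V → ¬ A.HasFunc ⟨n, j⟩ →
      Fold ⟨insert ⟨n, j⟩ F, V, {{A.inst (skolem j x)}}⟩ ⟨F, V, {{.ex A}}⟩
  | eve (F : Finset FVar) (V : Finset ℕ) (M : Mat) (g : FVar) :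
      ¬ M.HasFunc g → Fold ⟨insert g F, V, M⟩ ⟨F, V, M⟩

theorem Mat.not_hasVar_singleton_empty (y : ℕ) : ¬ Mat.HasVar y (insert ∅ ∅) := by
  simp [Mat.HasVar]

theorem Mat.not_hasFunc_singleton_empty (g : FVar) : ¬ Mat.HasFunc g (insert ∅ ∅) := by
  simp [Mat.HasFunc]

theorem Fold.rule {X Y : Proto} (h : Fold X Y) : RuleQDC X Y := by
  cases h with
  | and F V A B Γ ρ => exact .up (.and F V A B Γ ρ)
  | or F V A B Γ ρ => exact .up (.or F V A B Γ ρ)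
  | em F V A Γ ρ => exact .em F V A Γ ρ
  | absurd F V A ρ => exact .exp F V _ ρ
  | all F V A y h => exact .up (.all F V A ∅ ∅ y ⟨h, Mat.not_hasVar_singleton_empty y⟩)
  | ex F V A n j x hx h =>
    exact .up (.ex F V A ∅ ∅ n j x hx ⟨h, Mat.not_hasFunc_singleton_empty _⟩)
  | eve F V M g h => exact .eve F V M g h

/-- Duality exchanges premiss and conclusion: upward G-rules become downward ones, EM becomes NC,
Expansion becomes Deletion, and EVE becomes IVU. -/
theorem Fold.rule_dual {X Y : Proto} (h : Fold X Y) : RuleQDDC Y.dual X.dual := by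
  cases h with
  | and F V A B Γ ρ =>
    simp only [Proto.dual, Mat.dual_insert, Comp.dual_insert]
    exact .down (.or F V ..)
  | or F V A B Γ ρ =>
    simp only [Proto.dual, Mat.dual_insert, Comp.dual_insert]
    exact .down (.and F V ..)
  | em F V A Γ ρ =>
    simp only [Proto.dual, Mat.dual_insert, Comp.dual_insert]
    exact .nc F V ..
  | absurd F V A ρ =>
    simp only [Proto.dual, Mat.dual_insert]
    exact .del F V ..
  | all F V A y h =>
    have := GDual.ex F V A.dual ∅ ∅ y
      ⟨mt (Formula.hasVar_dual y A).1 h, Mat.not_hasVar_singleton_empty y⟩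
    simp only [Proto.dual, Mat.dual, Comp.dual, Finset.image_singleton, Formula.dual_inst]
    exact .down this
  | ex F V A n j x hx h =>
    have := GDual.all F V A.dual ∅ ∅ n j x hx
      ⟨mt (Formula.hasFunc_dual _ A).1 h, Mat.not_hasFunc_singleton_empty _⟩
    simp only [Proto.dual, Mat.dual, Comp.dual, Finset.image_singleton, Formula.dual_inst]
    exact .down this
  | eve F V M g h => exact .ivu F V M.dual g (mt (Mat.hasFunc_dual g M).1 h)

theorem Proto.VerifiedAsDatum.mono {D : Type} {I : Interp D} {F : Finset FVar} {V : Finset ℕ}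
    {M N : Mat} (h : ∀ J : Interp D, (∃ Γ ∈ N, ∀ A ∈ Γ, A.IsTrue J) → ∃ Γ ∈ M, ∀ A ∈ Γ, A.IsTrue J)
    (hN : Proto.VerifiedAsDatum I ⟨F, V, N⟩) : Proto.VerifiedAsDatum I ⟨F, V, M⟩ := by
  obtain ⟨Φ, hΦ, hN⟩ := hN
  exact ⟨Φ, hΦ, fun a ha => h _ (hN a ha)⟩

/-- This runs against the direction of inference. The matrix steps are equivalences of propositional
logic, and the existential step needs the axiom of choice to produce a Skolem function. -/
theorem Fold.verified {D : Type} {I : Interp D} {X Y : Proto} (h : Fold X Y)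
    (hY : Y.VerifiedAsDatum I) : X.VerifiedAsDatum I := by
  classical
  cases h with
  | and F V A B Γ ρ =>
    refine hY.mono fun J => ?_
    simp [Formula.IsTrue, Formula.Holds, and_assoc]
  | or F V A B Γ ρ =>
    refine hY.mono fun J => ?_
    simp only [Finset.exists_mem_insert, Finset.forall_mem_insert, Formula.IsTrue, Formula.Holds]
    tauto
  | em F V A Γ ρ =>
    refine hY.mono fun J => ?_
    simp only [Finset.exists_mem_insert, Finset.forall_mem_insert]
    tauto
  | absurd F V A ρ =>
    refine hY.mono fun J => ?_
    simp [Formula.IsTrue, Formula.Holds]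
  | all F V A y h =>
    obtain ⟨Φ, hΦ, hY⟩ := hY
    refine ⟨Φ, hΦ, fun a ha => ⟨_, Finset.mem_singleton_self _, fun B hB => ?_⟩⟩
    obtain rfl := Finset.mem_singleton.1 hB
    -- The variable `y` may be missing from the prefix of the conclusion, so it is reset to its
    -- value in `I`. The value `a y` is used instead to instantiate the quantifier.
    obtain ⟨Γ, hΓ, hY⟩ := hY (Function.update a y (I.ind y)) fun x hx => by
      by_cases e : x = y
      · rw [e, Function.update_self]
      · simp only [Function.update_of_ne e]
        exact ha x (by simpa [e] using hx)
    obtain rfl := Finset.mem_singleton.1 hΓ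
    have := hY _ (Finset.mem_singleton_self _) (a y)
    rw [Formula.isTrue_inst]
    refine (Formula.holds_congr ⟨Function.update a y (I.ind y), Φ, I.pred⟩ ⟨a, Φ, I.pred⟩ rfl A _
      (fun x hx => ?_) fun _ _ => rfl).2 this
    have e : x ≠ y := fun e => h (e ▸ hx)
    simp [e]
  | ex F V A n j x hx h =>
    obtain ⟨Φ, hΦ, hY⟩ := hY
    have hd : ∀ a : ℕ → D, (∀ x, x ∉ V → a x = I.ind x) →
        ∃ d, A.Holds ⟨a, Φ, I.pred⟩ (Fin.cons d Fin.elim0) := by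
      intro a ha
      obtain ⟨Γ, hΓ, hY⟩ := hY a ha
      obtain rfl := Finset.mem_singleton.1 hΓ
      exact hY _ (Finset.mem_singleton_self _)
    have : Nonempty D := ⟨I.ind 0⟩
    choose! d hd using hd
    -- A Skolem function sees only the values of the listed variables. They determine the whole
    -- assignment, because outside `V` it agrees with `I`.
    let asg : (Fin n → D) → ℕ → D := fun v z => if h : ∃ i, x i = z then v h.choose else I.ind z
    have hasg : ∀ a : ℕ → D, (∀ x, x ∉ V → a x = I.ind x) → asg (fun i => a (x i)) = a := by
      intro a ha
      funext z
      by_cases hz : ∃ i, x i = z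
      · simp only [asg, dif_pos hz, hz.choose_spec]
      · simp only [asg, dif_neg hz]
        refine (ha z fun hm => hz ?_).symm
        rw [← hx.2] at hm
        simpa using hm
    refine ⟨Function.update Φ ⟨n, j⟩ fun v => d (asg v), fun f hf => ?_, fun a ha =>
      ⟨_, Finset.mem_singleton_self _, fun B hB => ?_⟩⟩
    · rw [Finset.mem_insert, not_or] at hf
      rw [Function.update_of_ne hf.1]
      exact hΦ f hf.2
    · obtain rfl := Finset.mem_singleton.1 hB
      rw [Formula.isTrue_inst]
      refine (Formula.holds_congr ⟨a, Φ, I.pred⟩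
        ⟨a, Function.update Φ ⟨n, j⟩ fun v => d (asg v), I.pred⟩ rfl A _ (fun _ _ => rfl)
        fun f hf => ?_).2 ?_
      · have hne : f ≠ ⟨n, j⟩ := by
          rintro rfl
          exact h hf
        exact Function.update_of_ne hne _ _
      · have e : (skolem j x).eval ⟨a, Function.update Φ ⟨n, j⟩ fun v => d (asg v), I.pred⟩
            Fin.elim0 = d a := by
          simp only [skolem, Term.eval, Function.update_self]
          rw [hasg a ha]
        rw [e]
        exact hd a ha
  | eve F V M g h =>
    obtain ⟨Φ, hΦ, hY⟩ := hY
    exact ⟨Φ, fun f hf => hΦ f fun hm => hf (Finset.mem_insert_of_mem hm), hY⟩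


/-! ### Reduction of a matrix to one formula -/

/-- The side component `Δ` makes the induction work: a formula of `Γ` is parked there while the rest
is condensed, and is then conjoined. The empty conjunction is a tautology, introduced by EM and
disjunction. -/
theorem fold_comp (F : Finset FVar) (V : Finset ℕ) (Γ : Comp) :
    ∃ A : Formula 0, (∀ l, (∀ B ∈ Γ, B.InitialArgs l) → A.InitialArgs l) ∧
      (∀ g, A.HasFunc g → ∃ B ∈ Γ, B.HasFunc g) ∧
      ∀ (Δ : Comp) (ρ : Mat), Relation.ReflTransGen Fold ⟨F, V, insert (Δ ∪ Γ) ρ⟩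
        ⟨F, V, insert (insert A Δ) ρ⟩ := by
  induction Γ using Finset.induction with
  | empty =>
    refine ⟨.or propVar (.neg propVar), ?_, ?_, fun Δ ρ => ?_⟩
    · intro l _
      exact ⟨fun i => i.elim0, fun i => i.elim0⟩
    · rintro g (⟨i, _⟩ | ⟨i, _⟩) <;> exact i.elim0
    · rw [Finset.union_empty]
      exact .tail (.single (.em F V propVar Δ ρ)) (.or F V _ _ Δ ρ)
  | insert B Γ _ ih =>
    obtain ⟨A, h1, h2, h3⟩ := ih
    refine ⟨.and A B, fun l hl => ?_, ?_, fun Δ ρ => ?_⟩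
    · rw [Finset.forall_mem_insert] at hl
      exact ⟨h1 l hl.2, hl.1⟩
    · rintro g (h | h)
      · obtain ⟨C, hC, h⟩ := h2 g h
        exact ⟨C, Finset.mem_insert_of_mem hC, h⟩
      · exact ⟨B, Finset.mem_insert_self .., h⟩
    · have := h3 (insert B Δ) ρ
      rw [Finset.insert_union, ← Finset.union_insert] at this
      exact this.tail (.and F V A B Δ ρ)

/-- The same induction one level up, with disjunction in place of conjunction. The empty disjunction
is a contradiction, introduced by the restricted Expansion. -/
theorem fold_mat (F : Finset FVar) (V : Finset ℕ) (M : Mat) :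
    ∃ A : Formula 0, (∀ l, (∀ Γ ∈ M, ∀ B ∈ Γ, B.InitialArgs l) → A.InitialArgs l) ∧
      (∀ g, A.HasFunc g → M.HasFunc g) ∧
      ∀ N : Mat, Relation.ReflTransGen Fold ⟨F, V, N ∪ M⟩ ⟨F, V, insert {A} N⟩ := by
  induction M using Finset.induction with
  | empty =>
    refine ⟨.and propVar (.neg propVar), ?_, ?_, fun N => ?_⟩
    · intro l _
      exact ⟨fun i => i.elim0, fun i => i.elim0⟩
    · rintro g (⟨i, _⟩ | ⟨i, _⟩) <;> exact i.elim0
    · rw [Finset.union_empty]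
      exact .single (.absurd F V propVar N)
  | insert Γ M _ ih =>
    obtain ⟨A, h1, h2, h3⟩ := ih
    obtain ⟨B, b1, b2, b3⟩ := fold_comp F V Γ
    refine ⟨.or A B, fun l hl => ?_, ?_, fun N => ?_⟩
    · rw [Finset.forall_mem_insert] at hl
      exact ⟨h1 l hl.2, b1 l hl.1⟩
    · rintro g (h | h)
      · obtain ⟨Δ, hΔ, h⟩ := h2 g h
        exact ⟨Δ, Finset.mem_insert_of_mem hΔ, h⟩
      · exact ⟨Γ, Finset.mem_insert_self .., b2 g h⟩
    · have h4 := b3 ∅ (N ∪ M)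
      rw [Finset.empty_union, ← Finset.union_insert] at h4
      have h5 := h3 (insert {B} N)
      rw [Finset.insert_union] at h5
      exact (h4.trans h5).tail (.or F V A B ∅ N)

/-! ### Abstraction of a term from a formula -/

open Classical in
/-- Replacement of the term given as second argument by an outermost bound variable. -/
noncomputable def Term.abstract {k : ℕ} : Term k → Term k → Term (k + 1)
  | .var x, c => if .var x = c then .bvar (Fin.last k) else .var x
  | .bvar i, _ => .bvar i.castSucc
  | .app f args, c => if .app f args = c then .bvar (Fin.last k)
      else .app f fun i => (args i).abstract c

/-- Replacement of the term `c` by an outermost bound variable; `c k` is the form that the term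
takes in the scope of `k` quantifiers. -/
noncomputable def Formula.abstract (c : (k : ℕ) → Term k) : {k : ℕ} → Formula k → Formula (k + 1)
  | k, .atom P args => .atom P fun i => (args i).abstract (c k)
  | _, .neg A => .neg (A.abstract c)
  | _, .and A B => .and (A.abstract c) (B.abstract c)
  | _, .or A B => .or (A.abstract c) (B.abstract c)
  | _, .all A => .all (A.abstract c)
  | _, .ex A => .ex (A.abstract c)

theorem Term.bind_abstract {k : ℕ} {b : Fin (k + 1) → Term k}
    (hb : ∀ i : Fin k, b i.castSucc = .bvar i) (t : Term k) :
    (t.abstract (b (Fin.last k))).bind Term.var b = t := by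
  induction t with
  | var x =>
    rw [Term.abstract]
    split_ifs with h
    · exact h.symm
    · rfl
  | bvar i => exact hb i
  | app f args ih =>
    rw [Term.abstract]
    split_ifs with h
    · exact h.symm
    · simp only [Term.bind]
      congr 1
      funext i
      exact ih i

/-- The abstracted place is always the outermost index, `Fin.last`, so the inner indices keep their
numbers under quantifiers. The condition `hc` says that the abstracted term is the same at every
depth. -/
theorem Formula.bind_abstract {c : (k : ℕ) → Term k} (hc : ∀ k, (c k).lift = c (k + 1)) {k : ℕ}
    (A : Formula k) : ∀ {b : Fin (k + 1) → Term k}, (∀ i : Fin k, b i.castSucc = .bvar i) →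
    b (Fin.last k) = c k → (A.abstract c).bind Term.var b = A := by
  have key : ∀ {k : ℕ} {b : Fin (k + 1) → Term k}, (∀ i : Fin k, b i.castSucc = .bvar i) →
      ∀ i : Fin (k + 1), Fin.cases (motive := fun _ => Term (k + 1)) (.bvar 0)
        (fun i => (b i).lift) i.castSucc = .bvar i := by
    intro k b hb i
    cases i using Fin.cases with
    | zero => rfl
    | succ i =>
      rw [← Fin.succ_castSucc, Fin.cases_succ, hb]
      rfl
  induction A with
  | atom P args =>
    intro b hb hl
    simp only [Formula.abstract, Formula.bind, ← hl, Term.bind_abstract hb]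
  | neg A ih => intro b hb hl; exact congrArg Formula.neg (ih hb hl)
  | and A B ihA ihB => intro b hb hl; exact congrArg₂ Formula.and (ihA hb hl) (ihB hb hl)
  | or A B ihA ihB => intro b hb hl; exact congrArg₂ Formula.or (ihA hb hl) (ihB hb hl)
  | all A ih =>
    intro b hb hl
    refine congrArg Formula.all (ih (key hb) ?_)
    rw [← Fin.succ_last, Fin.cases_succ, hl, hc]
  | ex A ih =>
    intro b hb hl
    refine congrArg Formula.ex (ih (key hb) ?_)
    rw [← Fin.succ_last, Fin.cases_succ, hl, hc]

theorem Formula.inst_abstract {c : (k : ℕ) → Term k} (hc : ∀ k, (c k).lift = c (k + 1))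
    (A : Formula 0) : (A.abstract c).inst (c 0) = A :=
  Formula.bind_abstract hc A (fun i => i.elim0) rfl

theorem Term.hasFunc_of_abstract {k : ℕ} {c t : Term k} {g : FVar}
    (h : (t.abstract c).HasFunc g) : t.HasFunc g := by
  induction t with
  | var x =>
    rw [Term.abstract] at h
    split_ifs at h <;> exact h
  | bvar i => exact h
  | app f args ih =>
    rw [Term.abstract] at h
    split_ifs at h
    · exact h.elim
    · exact h.imp_right fun ⟨i, hi⟩ => ⟨i, ih i hi⟩

theorem Formula.hasFunc_of_abstract {c : (k : ℕ) → Term k} {g : FVar} {k : ℕ} {A : Formula k}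
    (h : (A.abstract c).HasFunc g) : A.HasFunc g := by
  induction A with
  | atom P args =>
    obtain ⟨i, hi⟩ := h
    exact ⟨i, Term.hasFunc_of_abstract hi⟩
  | neg A ih => exact ih h
  | and A B ihA ihB => exact h.imp ihA ihB
  | or A B ihA ihB => exact h.imp ihA ihB
  | all A ih => exact ih h
  | ex A ih => exact ih h

theorem Term.not_hasVar_abstract {k : ℕ} (x : ℕ) (t : Term k) :
    ¬ (t.abstract (.var x)).HasVar x := by
  induction t with
  | var y =>
    rw [Term.abstract]
    split_ifs with h
    · exact id
    · exact fun e => h (congrArg Term.var e)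
  | bvar i => exact id
  | app f args ih =>
    rw [Term.abstract]
    rw [if_neg (by simp)]
    rintro ⟨i, hi⟩
    exact ih i hi

theorem Formula.not_hasVar_abstract (x : ℕ) {k : ℕ} (A : Formula k) :
    ¬ (A.abstract fun _ => .var x).HasVar x := by
  induction A with
  | atom P args =>
    rintro ⟨i, hi⟩
    exact Term.not_hasVar_abstract x _ hi
  | neg A ih => exact ih
  | and A B ihA ihB => exact not_or_intro ihA ihB
  | or A B ihA ihB => exact not_or_intro ihA ihB
  | all A ih => exact ih
  | ex A ih => exact ih

/-- Here standardness is decisive. All terms with this head have the same arguments, the first `n`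
entries of `l`, so they all coincide with the abstracted term and disappear. Arguments are
variables, so nothing is hidden inside them. -/
theorem Term.not_hasFunc_abstract {k n j : ℕ} {l : List ℕ} {x : Fin n → ℕ}
    (hx : ∀ i : Fin n, l[(i : ℕ)]? = some (x i)) {t : Term k} (ht : t.InitialArgs l) :
    ¬ (t.abstract (.app ⟨n, j⟩ fun i => .var (x i))).HasFunc ⟨n, j⟩ := by
  cases t with
  | var y =>
    rw [Term.abstract, if_neg (by simp)]
    exact id
  | bvar i => exact id
  | app f args =>
    rw [Term.abstract]
    split_ifs with h
    · exact id
    · rintro (rfl | ⟨i, hi⟩)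
      · refine h (congrArg (Term.app _) (funext fun i => ?_))
        obtain ⟨y, hy, e⟩ := ht i
        rw [hx i, Option.some.injEq] at hy
        rw [e, hy]
      · obtain ⟨y, _, e⟩ := ht i
        simp only [e, Term.abstract, reduceCtorEq, if_false] at hi
        exact hi

theorem Formula.not_hasFunc_abstract {n j : ℕ} {l : List ℕ} {x : Fin n → ℕ}
    (hx : ∀ i : Fin n, l[(i : ℕ)]? = some (x i)) {k : ℕ} {A : Formula k} (hA : A.InitialArgs l) :
    ¬ (A.abstract fun _ => .app ⟨n, j⟩ fun i => .var (x i)).HasFunc ⟨n, j⟩ := by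
  induction A with
  | atom P args =>
    rintro ⟨i, hi⟩
    exact Term.not_hasFunc_abstract hx (hA i) hi
  | neg A ih => exact ih hA
  | and A B ihA ihB => exact not_or_intro (ihA hA.1) (ihB hA.2)
  | or A B ihA ihB => exact not_or_intro (ihA hA.1) (ihB hA.2)
  | all A ih => exact ih hA
  | ex A ih => exact ih hA

theorem Term.initialArgs_abstract {k : ℕ} {c t : Term k} {l l' : List ℕ} (ht : t.InitialArgs l)
    (h : ∀ f, t.HasFunc f → ∀ (i : Fin f.arity) (y : ℕ), l[(i : ℕ)]? = some y →
      l'[(i : ℕ)]? = some y ∧ .var y ≠ c) : (t.abstract c).InitialArgs l' := by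
  cases t with
  | var y =>
    rw [Term.abstract]
    split_ifs <;> trivial
  | bvar i => trivial
  | app f args =>
    rw [Term.abstract]
    split_ifs with e
    · trivial
    · intro i
      obtain ⟨y, hy, e⟩ := ht i
      obtain ⟨h1, h2⟩ := h f (Or.inl rfl) i y hy
      exact ⟨y, h1, by simp only [e, Term.abstract, if_neg h2]⟩

/-- The second list permits dropping the last variable of the ordering once no functional term
reaches it. The condition on `c` prevents an argument of a remaining functional term from being
abstracted. -/
theorem Formula.initialArgs_abstract {c : (k : ℕ) → Term k} {l l' : List ℕ} {k : ℕ}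
    {A : Formula k} (hA : A.InitialArgs l)
    (h : ∀ f, A.HasFunc f → ∀ (i : Fin f.arity) (y : ℕ), l[(i : ℕ)]? = some y →
      l'[(i : ℕ)]? = some y ∧ ∀ k, .var y ≠ c k) : (A.abstract c).InitialArgs l' := by
  induction A with
  | atom P args =>
    exact fun i => Term.initialArgs_abstract (hA i) fun f hf j y hy =>
      ⟨(h f ⟨i, hf⟩ j y hy).1, (h f ⟨i, hf⟩ j y hy).2 _⟩
  | neg A ih => exact ih hA h
  | and A B ihA ihB =>
    exact ⟨ihA hA.1 fun f hf => h f (Or.inl hf), ihB hA.2 fun f hf => h f (Or.inr hf)⟩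
  | or A B ihA ihB =>
    exact ⟨ihA hA.1 fun f hf => h f (Or.inl hf), ihB hA.2 fun f hf => h f (Or.inr hf)⟩
  | all A ih => exact ih hA h
  | ex A ih => exact ih hA h

/-! ### Elimination of the prefix -/

theorem Formula.arity_le_of_initialArgs {l : List ℕ} {g : FVar} {k : ℕ} {A : Formula k}
    (hA : A.InitialArgs l) (hg : A.HasFunc g) : g.arity ≤ l.length := by
  have key : ∀ {k : ℕ} {t : Term k}, t.InitialArgs l → t.HasFunc g → g.arity ≤ l.length := by
    intro k t ht hg
    cases t with
    | var x => exact hg.elim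
    | bvar i => exact hg.elim
    | app f args =>
      obtain rfl | ⟨i, hi⟩ := hg
      · by_contra! hlt
        -- With too large an arity, the argument place numbered `l.length` would need an entry
        -- beyond the end of the list.
        obtain ⟨y, hy, _⟩ := ht ⟨l.length, hlt⟩
        simp at hy
      · obtain ⟨y, _, e⟩ := ht i
        rw [e] at hi
        exact hi.elim
  induction A with
  | atom P args =>
    obtain ⟨i, hi⟩ := hg
    exact key (hA i) hi
  | neg A ih => exact ih hA hg
  | and A B ihA ihB => exact hg.elim (ihA hA.1) (ihB hA.2)
  | or A B ihA ihB => exact hg.elim (ihA hA.1) (ihB hA.2)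
  | all A ih => exact ih hA hg
  | ex A ih => exact ih hA hg

/-- A functional variable of `G` that occurs in `A` has arity exactly `l.length`, hence is applied
to the entire individual prefix, as the existential rule requires. One that does not occur is
discarded by EVE. -/
theorem fold_funcs {l : List ℕ} (hl : l.Nodup) (F G : Finset FVar)
    (hG : ∀ g ∈ G, l.length ≤ g.arity) : ∀ A : Formula 0, A.InitialArgs l →
    (∀ f, A.HasFunc f → f ∈ G ∪ F) → ∃ B : Formula 0, B.InitialArgs l ∧
      (∀ f, B.HasFunc f → f ∈ F) ∧
      Relation.ReflTransGen Fold ⟨G ∪ F, l.toFinset, {{A}}⟩ ⟨F, l.toFinset, {{B}}⟩ := by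
  induction G using Finset.induction with
  | empty =>
    intro A hA hF
    simp only [Finset.empty_union] at hF ⊢
    exact ⟨A, hA, hF, .refl⟩
  | insert g G _ ih =>
    intro A hA hF
    rw [Finset.forall_mem_insert] at hG
    simp only [Finset.insert_union, Finset.mem_insert] at hF ⊢
    by_cases hg : A.HasFunc g
    · obtain ⟨n, j⟩ := g
      have e : n = l.length :=
        le_antisymm (Formula.arity_le_of_initialArgs hA hg) hG.1
      subst e
      have hx : ∀ i : Fin l.length, l[(i : ℕ)]? = some (l.get i) := fun i => by simp
      set c : (k : ℕ) → Term k := fun k => .app ⟨l.length, j⟩ fun i => .var (l.get i) with hc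
      have hA' : (A.abstract c).inst (skolem j l.get) = A :=
        Formula.inst_abstract (c := c) (fun _ => rfl) A
      have hnot := Formula.not_hasFunc_abstract (j := j) hx hA
      obtain ⟨B, h1, h2, h3⟩ := ih hG.2 (.ex (A.abstract c))
        (Formula.initialArgs_abstract hA fun f _ i y hy => ⟨hy, fun k => by simp [hc]⟩)
        (fun f hf => (hF f (Formula.hasFunc_of_abstract hf)).resolve_left (by
          rintro rfl
          exact hnot hf))
      refine ⟨B, h1, h2, .head ?_ h3⟩
      have := Fold.ex (G ∪ F) l.toFinset (A.abstract c) _ j l.get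
        ⟨List.nodup_iff_injective_get.1 hl, by ext; simp [List.mem_iff_get]⟩ hnot
      rwa [hA'] at this
    · obtain ⟨B, h1, h2, h3⟩ := ih hG.2 A hA fun f hf =>
        (hF f hf).resolve_left fun e => hg (e ▸ hf)
      refine ⟨B, h1, h2, .head (.eve _ _ _ g ?_) h3⟩
      simpa [Mat.HasFunc] using hg

/-- Variables are removed from the end of the ordering. Before each removal, the functional
variables of full arity are turned into existential quantifiers. -/
theorem fold_prefix {l : List ℕ} : ∀ (F : Finset FVar) (A : Formula 0), l.Nodup →
    A.InitialArgs l → (∀ f, A.HasFunc f → f ∈ F) →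
    ∃ B : Formula 0, Relation.ReflTransGen Fold ⟨F, l.toFinset, {{A}}⟩ ⟨∅, ∅, {{B}}⟩ := by
  induction l using List.reverseRecOn with
  | nil =>
    intro F A hl hA hF
    -- With no individual variable left, every functional variable has sufficient arity, so `F` is
    -- eliminated entirely.
    obtain ⟨B, _, _, h⟩ := fold_funcs hl ∅ F (fun _ _ => Nat.zero_le _) A hA (by simpa using hF)
    rw [Finset.union_empty] at h
    exact ⟨B, h⟩
  | append_singleton l y ih =>
    intro F A hl hA hF
    have e : F.filter (fun f => (l ++ [y]).length ≤ f.arity) ∪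
        F.filter (fun f => ¬ (l ++ [y]).length ≤ f.arity) = F := Finset.filter_union_filter_not_eq ..
    obtain ⟨B, h1, h2, h3⟩ := fold_funcs hl (F.filter fun f => ¬ (l ++ [y]).length ≤ f.arity)
      (F.filter fun f => (l ++ [y]).length ≤ f.arity) (fun g hg => (Finset.mem_filter.1 hg).2) A hA
      (by rwa [e])
    rw [e] at h3
    set F' := F.filter fun f => ¬ (l ++ [y]).length ≤ f.arity with hF'
    have hy : y ∉ l := fun h => (List.nodup_append.1 hl).2.2 y h y (by simp) rfl
    obtain ⟨C, h4⟩ := ih F' (.all (B.abstract fun _ => .var y)) (List.nodup_append.1 hl).1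
      (Formula.initialArgs_abstract h1 fun f hf i z hz => by
        -- The functional variables left over have arity at most `l.length`, so their argument
        -- places stop short of `y`.
        have hlt : (i : ℕ) < l.length := by
          have := (Finset.mem_filter.1 (h2 f hf)).2
          have := i.2
          simp at *
          omega
        rw [List.getElem?_append_left hlt] at hz
        refine ⟨hz, fun k e => hy ?_⟩
        obtain rfl : z = y := by simpa using e
        exact List.mem_of_getElem? hz)
      (fun f hf => h2 f (Formula.hasFunc_of_abstract hf))
    refine ⟨C, h3.trans (.head ?_ h4)⟩
    have := Fold.all F' l.toFinset (B.abstract fun _ => .var y) y (Formula.not_hasVar_abstract y B)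
    rw [Formula.inst_abstract (c := fun _ => .var y) (fun _ => rfl)] at this
    have e : (l ++ [y]).toFinset = insert y l.toFinset := by ext; simp
    rwa [e]

theorem Proto.Standard.exists_fold {X : Proto} (h : X.Standard) :
    ∃ B : Formula 0, Relation.ReflTransGen Fold X ⟨∅, ∅, {{B}}⟩ := by
  obtain ⟨F, V, M⟩ := X
  obtain ⟨h1, l, hl, rfl, h2⟩ := h
  obtain ⟨A, a1, a2, a3⟩ := fold_mat F l.toFinset M
  obtain ⟨B, hB⟩ := fold_prefix F A hl (a1 l h2) fun f hf => h1 f (a2 f hf)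
  have := a3 ∅
  rw [Finset.empty_union] at this
  exact ⟨B, this.trans hB⟩

theorem verified_of_fold {D : Type} {I : Interp D} {X Y : Proto}
    (h : Relation.ReflTransGen Fold X Y) (hY : Y.VerifiedAsDatum I) : X.VerifiedAsDatum I := by
  induction h with
  | refl => exact hY
  | tail _ h ih => exact ih (h.verified hY)


/-! ### Countability and finiteness -/

instance : Countable FVar :=
  Function.Injective.countable (f := fun g : FVar => (g.arity, g.idx)) fun a b h => by
    cases a; cases b; simp_all

instance : Countable PVar :=
  Function.Injective.countable (f := fun g : PVar => (g.arity, g.idx)) fun a b h => by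
    cases a; cases b; simp_all

/-- Finitely branching trees with countably many labels are countable. Terms and formulas embed into
such trees, which gives the enumeration needed for the Henkin chain. -/
theorem countable_wType {α : Type} [Countable α] (ar : α → ℕ) :
    Countable (WType fun a => Fin (ar a)) := by
  have := Encodable.ofCountable α
  infer_instance

/-- The tree of a term. -/
def Term.toW {k : ℕ} : Term k →
    WType fun a : ℕ ⊕ Fin k ⊕ FVar => Fin (Sum.elim 0 (Sum.elim 0 FVar.arity) a)
  | .var x => ⟨.inl x, Fin.elim0⟩
  | .bvar i => ⟨.inr (.inl i), Fin.elim0⟩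
  | .app f args => ⟨.inr (.inr f), fun i => (args i).toW⟩

theorem Term.toW_injective {k : ℕ} : Function.Injective (Term.toW (k := k)) := by
  intro t
  induction t with
  | var x =>
    intro t' h
    cases t' <;> injection h with h _ <;> simp_all
  | bvar i =>
    intro t' h
    cases t' <;> injection h with h _ <;> simp_all
  | app f args ih =>
    intro t' h
    cases t' with
    | var x => injection h with h _; simp at h
    | bvar i => injection h with h _; simp at h
    | app f' args' =>
      injection h with h1 h2
      simp only [Sum.inr.injEq] at h1
      subst h1
      exact congrArg (Term.app f) (funext fun i => ih i (congrFun (eq_of_heq h2) i))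

instance {k : ℕ} : Countable (Term k) :=
  have := countable_wType (Sum.elim 0 (Sum.elim 0 FVar.arity) : ℕ ⊕ Fin k ⊕ FVar → ℕ)
  Term.toW_injective.countable

/-- The number of immediate subformulas, for atomic formulas and the five other shapes. -/
def formulaArity : (Σ (k : ℕ) (P : PVar), Fin P.arity → Term k) ⊕ Fin 5 → ℕ :=
  Sum.elim 0 ![1, 2, 2, 1, 1]

/-- The tree of a formula. -/
def Formula.toW : {k : ℕ} → Formula k → WType fun a => Fin (formulaArity a)
  | k, .atom P args => ⟨.inl ⟨k, P, args⟩, Fin.elim0⟩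
  | _, .neg A => ⟨.inr 0, fun _ : Fin 1 => A.toW⟩
  | _, .and A B => ⟨.inr 1, Fin.cons A.toW fun _ : Fin 1 => B.toW⟩
  | _, .or A B => ⟨.inr 2, Fin.cons A.toW fun _ : Fin 1 => B.toW⟩
  | _, .all A => ⟨.inr 3, fun _ : Fin 1 => A.toW⟩
  | _, .ex A => ⟨.inr 4, fun _ : Fin 1 => A.toW⟩

theorem Formula.toW_injective {k : ℕ} : Function.Injective (Formula.toW (k := k)) := by
  intro A
  induction A with
  | atom P args =>
    intro B h
    cases B <;> injection h with h1 _ <;> simp at h1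
    obtain ⟨rfl, h1⟩ := h1
    rw [eq_of_heq h1]
  | neg A ih =>
    intro B h
    cases B <;> injection h with h1 h2 <;> simp at h1
    rw [ih (congrFun h2 (0 : Fin 1))]
  | and A B ihA ihB =>
    intro C h
    cases C <;> injection h with h1 h2 <;> simp at h1
    rw [ihA (congrFun h2 (0 : Fin 2)), ihB (congrFun h2 (1 : Fin 2))]
  | or A B ihA ihB =>
    intro C h
    cases C <;> injection h with h1 h2 <;> simp at h1
    rw [ihA (congrFun h2 (0 : Fin 2)), ihB (congrFun h2 (1 : Fin 2))]
  | all A ih =>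
    intro B h
    cases B <;> injection h with h1 h2 <;> simp at h1
    rw [ih (congrFun h2 (0 : Fin 1))]
  | ex A ih =>
    intro B h
    cases B <;> injection h with h1 h2 <;> simp at h1
    rw [ih (congrFun h2 (0 : Fin 1))]

instance {k : ℕ} : Countable (Formula k) :=
  have := countable_wType formulaArity
  Formula.toW_injective.countable

/-! ### Finiteness of the variables that occur, and fresh variables -/

theorem Term.finite_hasVar {k : ℕ} (t : Term k) : {x | t.HasVar x}.Finite := by
  induction t with
  | var y => exact (Set.finite_singleton y).subset fun x h => Eq.symm h
  | bvar i => exact Set.finite_empty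
  | app f args ih => simpa only [Term.HasVar, Set.ofPred_exists] using Set.finite_iUnion ih

theorem Term.finite_hasFunc {k : ℕ} (t : Term k) : {g | t.HasFunc g}.Finite := by
  induction t with
  | var y => exact Set.finite_empty
  | bvar i => exact Set.finite_empty
  | app f args ih =>
    refine ((Set.finite_singleton f).union (Set.finite_iUnion ih)).subset ?_
    rintro g (rfl | ⟨i, hi⟩)
    · exact Or.inl rfl
    · exact Or.inr (Set.mem_iUnion.2 ⟨i, hi⟩)

theorem Formula.finite_hasVar {k : ℕ} (A : Formula k) : {x | A.HasVar x}.Finite := by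
  induction A with
  | atom P args =>
    simpa only [Formula.HasVar, Set.ofPred_exists] using
      Set.finite_iUnion fun i => (args i).finite_hasVar
  | neg A ih => exact ih
  | and A B ihA ihB => exact ihA.union ihB
  | or A B ihA ihB => exact ihA.union ihB
  | all A ih => exact ih
  | ex A ih => exact ih

theorem Formula.finite_hasFunc {k : ℕ} (A : Formula k) : {g | A.HasFunc g}.Finite := by
  induction A with
  | atom P args =>
    simpa only [Formula.HasFunc, Set.ofPred_exists] using
      Set.finite_iUnion fun i => (args i).finite_hasFunc
  | neg A ih => exact ih
  | and A B ihA ihB => exact ihA.union ihB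
  | or A B ihA ihB => exact ihA.union ihB
  | all A ih => exact ih
  | ex A ih => exact ih

theorem Mat.finite_hasVar (M : Mat) : {x | M.HasVar x}.Finite := by
  refine (M.finite_toSet.biUnion fun Γ _ =>
    Γ.finite_toSet.biUnion fun A _ => A.finite_hasVar).subset ?_
  rintro x ⟨Γ, hΓ, A, hA, h⟩
  exact Set.mem_biUnion hΓ (Set.mem_biUnion hA h)

theorem exists_freshVar (A : Formula 1) (Γ : Comp) (ρ : Mat) : ∃ y, FreshVar y A Γ ρ := by
  obtain ⟨y, hy⟩ := (A.finite_hasVar.union (Mat.finite_hasVar (insert Γ ρ))).exists_notMem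
  exact ⟨y, not_or.1 hy⟩

theorem Comp.exists_fresh_const (Γ : Comp) : ∃ j, ∀ A ∈ Γ, ¬ A.HasFunc ⟨0, j⟩ := by
  have h := (Γ.finite_toSet.biUnion fun A _ => A.finite_hasFunc).preimage
    (f := fun j => (⟨0, j⟩ : FVar)) fun a _ b _ h => by simpa using h
  obtain ⟨j, hj⟩ := h.exists_notMem
  exact ⟨j, fun A hA h => hj (Set.mem_biUnion hA h)⟩

/-! ### Refutable components -/

/-- The component can be removed from every datum that has no individual prefix and whose other
components contain no further functional variables. -/
def Refutable (Γ : Comp) : Prop :=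
  -- The condition on `ρ` guarantees that a constant fresh for `Γ` is fresh for the whole matrix.
  ∀ (F : Finset FVar) (ρ : Mat), (∀ g, ρ.HasFunc g → ∃ A ∈ Γ, A.HasFunc g) →
    Relation.ReflTransGen RuleQDC ⟨F, ∅, insert Γ ρ⟩ ⟨F, ∅, ρ⟩

theorem ruleQDC_clash (F : Finset FVar) (V : Finset ℕ) (ρ : Mat) {Γ : Comp} {A : Formula 0}
    (h : A ∈ Γ) (h' : .neg A ∈ Γ) : RuleQDC ⟨F, V, insert Γ ρ⟩ ⟨F, V, ρ⟩ := by
  have := RuleQDC.nc F V A Γ ρ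
  rwa [Finset.insert_eq_self.2 h', Finset.insert_eq_self.2 h] at this

/-- Components are sets, so a member of `Γ` may be regarded as added once more. An analytic rule can
then be used without losing its principal formula. -/
theorem ruleQDC_of_mem {F F' : Finset FVar} {V V' : Finset ℕ} {A : Formula 0} {Γ : Comp}
    {ρ M : Mat} (h : A ∈ Γ) (hr : GData ⟨F, V, insert (insert A Γ) ρ⟩ ⟨F', V', M⟩) :
    RuleQDC ⟨F, V, insert Γ ρ⟩ ⟨F', V', M⟩ := by
  rw [Finset.insert_eq_self.2 h] at hr
  exact .down hr

theorem Refutable.clash {Γ : Comp} {A : Formula 0} (h : A ∈ Γ) (h' : .neg A ∈ Γ) :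
    Refutable Γ := fun F ρ _ => .single (ruleQDC_clash F ∅ ρ h h')

/-- Here and in the next three lemmas, one analytic step is followed by one application of NC to
each component it produces. -/
theorem Refutable.and {Γ : Comp} {A B : Formula 0} (h : .and A B ∈ Γ)
    (h' : .neg A ∈ Γ ∨ .neg B ∈ Γ) : Refutable Γ := by
  intro F ρ _
  refine .head (ruleQDC_of_mem h (.and F ∅ A B Γ ρ)) (.single ?_)
  obtain h' | h' := h'
  · exact ruleQDC_clash F ∅ ρ (A := A) (by simp) (by simp [h'])
  · exact ruleQDC_clash F ∅ ρ (A := B) (by simp) (by simp [h'])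

theorem Refutable.negAnd {Γ : Comp} {A B : Formula 0} (h : .neg (.and A B) ∈ Γ)
    (hA : A ∈ Γ) (hB : B ∈ Γ) : Refutable Γ := by
  intro F ρ _
  refine .head (ruleQDC_of_mem h (.negAnd F ∅ A B Γ ρ))
    (.head (b := ⟨F, ∅, insert (insert (.neg B) Γ) ρ⟩) ?_ (.single ?_))
  · exact ruleQDC_clash F ∅ _ (A := A) (by simp [hA]) (by simp)
  · exact ruleQDC_clash F ∅ ρ (A := B) (by simp [hB]) (by simp)

theorem Refutable.or {Γ : Comp} {A B : Formula 0} (h : .or A B ∈ Γ)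
    (hA : .neg A ∈ Γ) (hB : .neg B ∈ Γ) : Refutable Γ := by
  intro F ρ _
  refine .head (ruleQDC_of_mem h (.or F ∅ A B Γ ρ))
    (.head (b := ⟨F, ∅, insert (insert B Γ) ρ⟩) ?_ (.single ?_))
  · exact ruleQDC_clash F ∅ _ (A := A) (by simp) (by simp [hA])
  · exact ruleQDC_clash F ∅ ρ (A := B) (by simp) (by simp [hB])

theorem Refutable.negOr {Γ : Comp} {A B : Formula 0} (h : .neg (.or A B) ∈ Γ)
    (h' : A ∈ Γ ∨ B ∈ Γ) : Refutable Γ := by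
  intro F ρ _
  refine .head (ruleQDC_of_mem h (.negOr F ∅ A B Γ ρ)) (.single ?_)
  obtain h' | h' := h'
  · exact ruleQDC_clash F ∅ ρ (A := A) (by simp [h']) (by simp)
  · exact ruleQDC_clash F ∅ ρ (A := B) (by simp [h']) (by simp)

/-- Inst substitutes throughout the matrix; when the variable is fresh, only the newly introduced
formula is affected. -/
theorem Mat.subst_insert_insert {s : ℕ → Term 0} (A : Formula 0) {Γ : Comp} {ρ : Mat}
    (h : ∀ x, Mat.HasVar x (insert Γ ρ) → s x = .var x) :
    Mat.subst s (insert (insert A Γ) ρ) = insert (insert (A.subst s) Γ) ρ := by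
  have key : ∀ Δ ∈ insert Γ ρ, Δ.image (Formula.subst s) = Δ := by
    intro Δ hΔ
    conv_rhs => rw [← Finset.image_id (s := Δ)]
    exact Finset.image_congr fun B hB => Formula.subst_eq_self fun x hx => h x ⟨Δ, hΔ, B, hB, hx⟩
  have hρ : ρ.image (fun Γ => Γ.image (Formula.subst s)) = ρ := by
    conv_rhs => rw [← Finset.image_id (s := ρ)]
    exact Finset.image_congr fun Δ hΔ => key Δ (Finset.mem_insert_of_mem hΔ)
  rw [Mat.subst, Finset.image_insert, Finset.image_insert, key Γ (Finset.mem_insert_self ..), hρ]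

/-- The quantifier is moved into the prefix as a fresh variable, which Inst at once replaces by `t`.
The individual prefix is then empty again, and NC applies. -/
theorem Refutable.all {Γ : Comp} {A : Formula 1} {t : Term 0} (h : .all A ∈ Γ)
    (h' : .neg (A.inst t) ∈ Γ) : Refutable Γ := by
  intro F ρ _
  obtain ⟨y, hy⟩ := exists_freshVar A Γ ρ
  have hi := RuleQDC.inst F ∅ (insert (insert (A.inst (.var y)) Γ) ρ) y t
  rw [Mat.subst_insert_insert _ fun x hx => ?_, Formula.subst_inst_var hy.1] at hi
  · exact .head (ruleQDC_of_mem h (.all F ∅ A Γ ρ y hy)) (.head hi (.single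
      (ruleQDC_clash F ∅ ρ (A := A.inst t) (by simp) (by simp [h']))))
  · have hne : x ≠ y := by
      rintro rfl
      exact hy.2 hx
    exact Function.update_of_ne hne _ _

theorem Refutable.negEx {Γ : Comp} {A : Formula 1} {t : Term 0} (h : .neg (.ex A) ∈ Γ)
    (h' : A.inst t ∈ Γ) : Refutable Γ := by
  intro F ρ _
  obtain ⟨y, hy⟩ := exists_freshVar A Γ ρ
  have hi := RuleQDC.inst F ∅ (insert (insert (.neg (A.inst (.var y))) Γ) ρ) y t
  have e : (Formula.neg (A.inst (.var y))).subst (single y t) = .neg (A.inst t) :=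
    congrArg Formula.neg (Formula.subst_inst_var hy.1 t)
  rw [Mat.subst_insert_insert _ fun x hx => ?_, e] at hi
  · exact .head (ruleQDC_of_mem h (.negEx F ∅ A Γ ρ y hy)) (.head hi (.single
      (ruleQDC_clash F ∅ ρ (A := A.inst t) (by simp [h']) (by simp))))
  · have hne : x ≠ y := by
      rintro rfl
      exact hy.2 hx
    exact Function.update_of_ne hne _ _

/-- The constant with index `j`. -/
def const (j : ℕ) : Term 0 := skolem j (Fin.elim0 : Fin 0 → ℕ)

theorem lists_elim0 : Lists (Fin.elim0 : Fin 0 → ℕ) ∅ := ⟨fun i => i.elim0, rfl⟩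

theorem freshFunc_of_mem {g : FVar} {A : Formula 1} {B : Formula 0} {Γ : Comp} {ρ : Mat}
    (h : B ∈ Γ) (hB : A.HasFunc g → B.HasFunc g) (hg : ∀ A ∈ Γ, ¬ A.HasFunc g)
    (hρ : ∀ g, ρ.HasFunc g → ∃ A ∈ Γ, A.HasFunc g) : FreshFunc g A Γ ρ := by
  refine ⟨fun hA => hg B h (hB hA), ?_⟩
  rintro ⟨Δ, hΔ, C, hC, hCg⟩
  obtain rfl | hΔ := Finset.mem_insert.1 hΔ
  · exact hg C hC hCg
  · obtain ⟨A, hA, h⟩ := hρ g ⟨Δ, hΔ, C, hC, hCg⟩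
    exact hg A hA h

/-- Over an empty individual prefix the Skolem term is a constant. After the component has been
removed, the constant no longer occurs in the matrix and EVE deletes it from the prefix. -/
theorem Refutable.ex {Γ : Comp} {A : Formula 1} {j : ℕ} (h : .ex A ∈ Γ)
    (hj : ∀ A ∈ Γ, ¬ A.HasFunc ⟨0, j⟩) (hr : Refutable (insert (A.inst (const j)) Γ)) :
    Refutable Γ := by
  intro F ρ hρ
  refine .head (ruleQDC_of_mem h (.ex F ∅ A Γ ρ 0 j _ lists_elim0
    (freshFunc_of_mem h id hj hρ))) (.tail (hr _ ρ fun g hg => ?_) (.eve F ∅ ρ _ fun hg => ?_))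
  · obtain ⟨B, hB, h⟩ := hρ g hg
    exact ⟨B, Finset.mem_insert_of_mem hB, h⟩
  · obtain ⟨B, hB, h⟩ := hρ _ hg
    exact hj B hB h

theorem Refutable.negAll {Γ : Comp} {A : Formula 1} {j : ℕ} (h : .neg (.all A) ∈ Γ)
    (hj : ∀ A ∈ Γ, ¬ A.HasFunc ⟨0, j⟩) (hr : Refutable (insert (.neg (A.inst (const j))) Γ)) :
    Refutable Γ := by
  intro F ρ hρ
  refine .head (ruleQDC_of_mem h (.negAll F ∅ A Γ ρ 0 j _ lists_elim0
    (freshFunc_of_mem h id hj hρ))) (.tail (hr _ ρ fun g hg => ?_) (.eve F ∅ ρ _ fun hg => ?_))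
  · obtain ⟨B, hB, h⟩ := hρ g hg
    exact ⟨B, Finset.mem_insert_of_mem hB, h⟩
  · obtain ⟨B, hB, h⟩ := hρ _ hg
    exact hj B hB h

/-- EM splits the component and the halves are removed in turn. During the first removal the second
half belongs to the rest, which is allowed because its functional variables occur in `A` or `Γ`. -/
theorem Refutable.cut {Γ : Comp} {A : Formula 0} (h : Refutable (insert A Γ))
    (h' : Refutable (insert (.neg A) Γ)) : Refutable Γ := by
  intro F ρ hρ
  refine .head (.em F ∅ A Γ ρ) (.trans (h F _ ?_) (h' F ρ fun g hg => ?_))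
  · rintro g ⟨Δ, hΔ, B, hB, hg⟩
    obtain rfl | hΔ := Finset.mem_insert.1 hΔ
    · obtain rfl | hB := Finset.mem_insert.1 hB
      · exact ⟨A, Finset.mem_insert_self .., hg⟩
      · exact ⟨B, Finset.mem_insert_of_mem hB, hg⟩
    · obtain ⟨C, hC, h⟩ := hρ g ⟨Δ, hΔ, B, hB, hg⟩
      exact ⟨C, Finset.mem_insert_of_mem hC, h⟩
  · obtain ⟨B, hB, h⟩ := hρ g hg
    exact ⟨B, Finset.mem_insert_of_mem hB, h⟩

/-! ### Completeness -/

/-- The component contains the formula or its negation, with a witness if that is existential. -/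
def Comp.Decides (Γ : Comp) (A : Formula 0) : Prop :=
  (A ∈ Γ ∧ ∀ B, A = .ex B → ∃ t, B.inst t ∈ Γ) ∨
    (.neg A ∈ Γ ∧ ∀ B, A = .all B → ∃ t, .neg (B.inst t) ∈ Γ)

/-- By cut, `A` or its negation can be added. If this calls for a witness, a fresh constant serves,
by `Refutable.ex` and `Refutable.negAll`. -/
theorem exists_decides {Γ : Comp} (h : ¬ Refutable Γ) (A : Formula 0) :
    ∃ Δ : Comp, Γ ⊆ Δ ∧ ¬ Refutable Δ ∧ Δ.Decides A := by
  by_cases hA : Refutable (insert A Γ)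
  · have hA' : ¬ Refutable (insert (.neg A) Γ) := fun hA' => h (hA.cut hA')
    by_cases e : ∃ B, A = .all B
    · obtain ⟨B, rfl⟩ := e
      obtain ⟨j, hj⟩ := Comp.exists_fresh_const (insert (.neg (.all B)) Γ)
      refine ⟨insert (.neg (B.inst (const j))) (insert (.neg (.all B)) Γ), fun C hC => by simp [hC],
        fun hr => hA' (.negAll (by simp) hj hr), .inr ⟨by simp, fun C hC => ?_⟩⟩
      cases hC
      exact ⟨const j, by simp⟩
    · exact ⟨_, Finset.subset_insert .., hA', .inr ⟨by simp, fun B hB => (e ⟨B, hB⟩).elim⟩⟩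
  · by_cases e : ∃ B, A = .ex B
    · obtain ⟨B, rfl⟩ := e
      obtain ⟨j, hj⟩ := Comp.exists_fresh_const (insert (.ex B) Γ)
      refine ⟨insert (B.inst (const j)) (insert (.ex B) Γ), fun C hC => by simp [hC],
        fun hr => hA (.ex (by simp) hj hr), .inl ⟨by simp, fun C hC => ?_⟩⟩
      cases hC
      exact ⟨const j, by simp⟩
    · exact ⟨_, Finset.subset_insert .., hA, .inl ⟨by simp, fun B hB => (e ⟨B, hB⟩).elim⟩⟩

/-- Every irrefutable component is included in the union of a chain of irrefutable components that
decides all formulas. -/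
theorem exists_chain {Γ : Comp} (h : ¬ Refutable Γ) :
    ∃ S : ℕ → Comp, S 0 = Γ ∧ Monotone S ∧ (∀ n, ¬ Refutable (S n)) ∧
      ∀ A, ∃ n, (S n).Decides A := by
  have : Nonempty (Formula 0) := ⟨propVar⟩
  obtain ⟨e, he⟩ := exists_surjective_nat (Formula 0)
  choose next h1 h2 h3 using fun (Δ : {Γ : Comp // ¬ Refutable Γ}) A => exists_decides Δ.2 A
  let S : ℕ → {Γ : Comp // ¬ Refutable Γ} :=
    fun n => n.rec ⟨Γ, h⟩ fun n Δ => ⟨next Δ (e n), h2 Δ (e n)⟩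
  refine ⟨fun n => (S n).1, rfl, monotone_nat_of_le_succ fun n => h1 (S n) (e n),
    fun n => (S n).2, fun A => ?_⟩
  obtain ⟨n, rfl⟩ := he A
  -- Stage `n + 1` was formed from stage `n` by deciding `e n`.
  exact ⟨n + 1, h3 (S n) (e n)⟩

/-- The interpretation by terms in which the atomic formulas of the given set are true. -/
def termInterp (T : Set (Formula 0)) : Interp (Term 0) :=
  ⟨Term.var, Term.app, fun P args => .atom P args ∈ T⟩

theorem Term.eval_termInterp (T : Set (Formula 0)) {k : ℕ} (e : Fin k → Term 0) (t : Term k) :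
    t.eval (termInterp T) e = t.bind Term.var e := by
  induction t with
  | var x => rfl
  | bvar i => rfl
  | app f args ih =>
    simp only [Term.eval, ih]
    rfl

/-- Henkin's argument. Let `T` be the union of a deciding chain of irrefutable components. A
violation of a truth condition in `T` involves at most three formulas, which lie together in one
stage and would make it refutable. Hence the term interpretation given by `T` makes exactly the
formulas of `T` true. -/
theorem Refutable.of_unsatisfiable {Γ : Comp}
    (h : ∀ I : Interp (Term 0), ¬ ∀ A ∈ Γ, A.IsTrue I) : Refutable Γ := by
  by_contra hΓ
  obtain ⟨S, hS0, hmono, hcon, hdec⟩ := exists_chain hΓ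
  let T : Set (Formula 0) := {A | ∃ n, A ∈ S n}
  have common : ∀ {A B C}, A ∈ T → B ∈ T → C ∈ T →
      ∃ n, A ∈ S n ∧ B ∈ S n ∧ C ∈ S n := by
    rintro A B C ⟨i, hi⟩ ⟨j, hj⟩ ⟨k, hk⟩
    exact ⟨max i (max j k), hmono (by simp) hi, hmono (by simp) hj, hmono (by simp) hk⟩
  have hneg : ∀ A, .neg A ∈ T ↔ A ∉ T := by
    intro A
    constructor
    · intro h1 h2
      obtain ⟨n, h1, h2, _⟩ := common h1 h2 h2
      exact hcon n (.clash h2 h1)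
    · intro h1
      obtain ⟨n, hn⟩ := hdec A
      exact hn.elim (fun h => (h1 ⟨n, h.1⟩).elim) fun h => ⟨n, h.1⟩
  have hand : ∀ A B, .and A B ∈ T ↔ A ∈ T ∧ B ∈ T := by
    intro A B
    constructor
    · intro h
      by_contra h'
      rw [not_and_or, ← hneg, ← hneg] at h'
      obtain h' | h' := h'
      · obtain ⟨n, h1, h2, _⟩ := common h h' h'
        exact hcon n (.and h1 (.inl h2))
      · obtain ⟨n, h1, h2, _⟩ := common h h' h'
        exact hcon n (.and h1 (.inr h2))
    · rintro ⟨hA, hB⟩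
      by_contra h
      rw [← hneg] at h
      obtain ⟨n, h1, h2, h3⟩ := common h hA hB
      exact hcon n (.negAnd h1 h2 h3)
  have hor : ∀ A B, .or A B ∈ T ↔ A ∈ T ∨ B ∈ T := by
    intro A B
    constructor
    · intro h
      by_contra h'
      rw [not_or, ← hneg, ← hneg] at h'
      obtain ⟨n, h1, h2, h3⟩ := common h h'.1 h'.2
      exact hcon n (.or h1 h2 h3)
    · intro h'
      by_contra h
      rw [← hneg] at h
      obtain h' | h' := h'
      · obtain ⟨n, h1, h2, _⟩ := common h h' h'
        exact hcon n (.negOr h1 (.inl h2))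
      · obtain ⟨n, h1, h2, _⟩ := common h h' h'
        exact hcon n (.negOr h1 (.inr h2))
  have hall : ∀ A : Formula 1, .all A ∈ T ↔ ∀ t, A.inst t ∈ T := by
    intro A
    constructor
    · intro h t
      by_contra h'
      rw [← hneg] at h'
      obtain ⟨n, h1, h2, _⟩ := common h h' h'
      exact hcon n (.all h1 h2)
    · intro h
      -- If the negation had been chosen, the chain would also contain a counterinstance.
      obtain ⟨n, hn | hn⟩ := hdec (.all A)
      · exact ⟨n, hn.1⟩
      · obtain ⟨t, ht⟩ := hn.2 A rfl
        exact ((hneg _).1 ⟨n, ht⟩ (h t)).elim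
  have hex : ∀ A : Formula 1, .ex A ∈ T ↔ ∃ t, A.inst t ∈ T := by
    intro A
    constructor
    · intro h
      obtain ⟨n, hn | hn⟩ := hdec (.ex A)
      · obtain ⟨t, ht⟩ := hn.2 A rfl
        exact ⟨t, n, ht⟩
      · exact ((hneg _).1 ⟨n, hn.1⟩ h).elim
    · rintro ⟨t, h'⟩
      by_contra h
      rw [← hneg] at h
      obtain ⟨n, h1, h2, _⟩ := common h h' h'
      exact hcon n (.negEx h1 h2)
  -- Open formulas are included, with terms for their indices, so that the induction passes through
  -- quantifiers.
  have truth : ∀ {k : ℕ} (A : Formula k) (e : Fin k → Term 0),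
      A.bind Term.var e ∈ T ↔ A.Holds (termInterp T) e := by
    intro k A
    induction A with
    | atom P args =>
      intro e
      simp only [Formula.bind, Formula.Holds, Term.eval_termInterp]
      rfl
    | neg A ih => intro e; exact (hneg _).trans (not_congr (ih e))
    | and A B ihA ihB => intro e; exact (hand ..).trans (and_congr (ihA e) (ihB e))
    | or A B ihA ihB => intro e; exact (hor ..).trans (or_congr (ihA e) (ihB e))
    | all A ih =>
      intro e
      refine (hall _).trans (forall_congr' fun t => ?_)
      rw [Formula.bind_all_inst]
      exact ih _
    | ex A ih =>
      intro e
      refine (hex _).trans (exists_congr fun t => ?_)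
      rw [Formula.bind_all_inst]
      exact ih _
  refine h (termInterp T) fun A hA => (truth A _).1 ?_
  have e : A.bind Term.var Fin.elim0 = A := A.subst_eq_self fun _ _ => rfl
  rw [e]
  exact ⟨0, hS0 ▸ hA⟩

/-- Every consequence of a formula can be inferred from it. -/
theorem steps_of_consequence {A B : Formula 0}
    (h : ∀ I : Interp (Term 0), A.IsTrue I → B.IsTrue I) :
    Relation.ReflTransGen RuleQDC ⟨∅, ∅, {{A}}⟩ ⟨∅, ∅, {{B}}⟩ := by
  have hr : Refutable (insert (.neg B) {A}) := by
    refine .of_unsatisfiable fun I hI => ?_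
    rw [Finset.forall_mem_insert] at hI
    exact hI.1 (h I (hI.2 A (Finset.mem_singleton_self A)))
  have h1 := RuleQDC.em ∅ ∅ B {A} ∅
  -- The rest is the component `B, A`, whose functional variables all occur in the refutable
  -- component `¬B, A`.
  have h2 := hr ∅ (insert (insert B {A}) ∅) (by simp [Mat.HasFunc, Formula.HasFunc])
  have h3 := RuleQDC.del ∅ ∅ {B} {A} ∅
  rw [Finset.insert_comm] at h1
  exact .tail (.head h1 h2) h3

/-! ### Assembling the deduction -/

theorem stepCrCr_singleton (A : Formula 0) :
    StepCrCr (Proto.toDatum ⟨∅, ∅, {{A}}⟩) (Proto.toDual ⟨∅, ∅, {{A}}⟩) := by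
  refine ⟨_, _, rfl, rfl, by simp, by simp, _, _, ⟨Term.var, fun _ _ => rfl, rfl⟩,
    ⟨Term.var, fun _ _ => rfl, rfl⟩, ?_⟩
  intro Γ hΓ _ Δ hΔ _
  refine ⟨A.subst Term.var, ?_⟩
  simp_all [Mat.subst]

theorem Proto.verifiedAsDatum_of_isTrue {D : Type} {I : Interp D} {A : Formula 0}
    (h : A.IsTrue I) : Proto.VerifiedAsDatum I ⟨∅, ∅, {{A}}⟩ := by
  refine ⟨I.func, fun _ _ => rfl, fun a ha => ⟨{A}, by simp, fun B hB => ?_⟩⟩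
  obtain rfl : a = I.ind := funext fun x => ha x (by simp)
  rwa [Finset.mem_singleton.1 hB]

theorem steps_of_fold {X Y : Proto} (h : Relation.ReflTransGen Fold X Y) :
    Relation.ReflTransGen RuleQDC X Y := by
  induction h with
  | refl => exact .refl
  | tail _ h ih => exact .tail ih h.rule

theorem steps_dual_of_fold {X Y : Proto} (h : Relation.ReflTransGen Fold X Y) :
    Relation.ReflTransGen RuleQDDC Y.dual X.dual := by
  induction h with
  | refl => exact .refl
  | tail _ h ih => exact .head h.rule_dual ih

end QHC

theorem mainTheorem6 (α : QHC.Datum) (δ : QHC.DualDatum) (hα : α.Standard) (hδ : δ.Standard)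
    (h : QHC.Entails α δ) : QHC.Deducible α δ := by
  obtain ⟨X, rfl, hX⟩ := hα
  obtain ⟨Y, rfl, hY⟩ := hδ
  obtain ⟨A, hA⟩ := hX.exists_fold
  obtain ⟨B, hB⟩ := hY.dual.exists_fold
  have hAB : ∀ I : QHC.Interp (QHC.Term 0), A.IsTrue I → B.dual.IsTrue I := by
    intro I hI
    by_contra hB'
    -- If `B.dual` is false in `I`, then `B` is true under the complementary predicates. So the dual
    -- of `Y` is verified there as a datum, and `Y` fails in `I`.
    have hB' := not_not.1 ((QHC.Formula.holds_dual
      (I := ⟨I.ind, I.func, fun P v => ¬ I.pred P v⟩) (J := I) rfl rfl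
      (fun _ _ => not_not.symm) B _).not.1 hB')
    refine QHC.Proto.not_verifiedAsDual (QHC.verified_of_fold hB
      (QHC.Proto.verifiedAsDatum_of_isTrue hB')) (h _ I ?_)
    exact QHC.verified_of_fold hA (QHC.Proto.verifiedAsDatum_of_isTrue hI)
  have h1 : Relation.ReflTransGen QHC.RuleQDC X ⟨∅, ∅, {{B.dual}}⟩ :=
    (QHC.steps_of_fold hA).trans (QHC.steps_of_consequence hAB)
  -- The folding of `Y.dual`, dualized and read backwards, unfolds `B.dual` into `Y`.
  have h2 : Relation.ReflTransGen QHC.RuleQDDC ⟨∅, ∅, {{B.dual}}⟩ Y := by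
    have := QHC.steps_dual_of_fold hB
    rwa [QHC.Proto.dual_dual] at this
  exact ⟨_, _, h1.lift QHC.Proto.toDatum fun _ _ h => ⟨_, _, rfl, rfl, h⟩,
    QHC.stepCrCr_singleton B.dual, h2.lift QHC.Proto.toDual fun _ _ h => ⟨_, _, rfl, rfl, h⟩⟩
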